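/- Let $A$ be a finite alphabet with the discrete topology, and give $A^{\mathbb{Z}^d}$ the product topology, its Borel $\sigma$-algebra and the shift action $(\sigma_t x)(s)=x(s+t)$, $s,t\in\mathbb{Z}^d$. A nearest neighbor $\mathbb{Z}^d$ shift of finite type (SFT) with alphabet $A$ is a nonempty set of the form $X=\{x\in A^{\mathbb{Z}^d} : (x(t),x(t+e_i))\notin F_i \text{ for all } t\in\mathbb{Z}^d,\ 1\le i\le d\}$ with $F_1,\dots,F_d\subseteq A\times A$. For finite $S\subset\mathbb{Z}^d$ let $L_S(X)=\{x|_S : x\in X\}$. The topological entropy of $X$ is $$h(X)=\lim_{n_1,\dots,n_d\to\infty}\frac{\log|L_{\prod_i[1,n_i]}(X)|}{n_1\cdots n_d},$$ and the entropy of a shift-invariant Borel probability measure $\mu$ on $A^{\mathbb{Z}^d}$ is $$h(\mu)=\lim_{n_1,\dots,n_d\to\infty}\frac{-1}{n_1\cdots n_d}\sum_{w\in A^{\prod_i[1,n_i]}}\mu([w])\log\mu([w]),$$ where $[w]$ is the set of points whose restriction to $\prod_i[1,n_i]$ is $w$, and $0\log 0=0$. A measure of maximal entropy on $X$ is a shift-invariant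 Borel probability measure $\mu$ with support contained in $X$ and $h(\mu)=h(X)$. Define $$\alpha_d=\inf\{\alpha\in\mathbb{R} : \text{there is a nearest neighbor } \mathbb{Z}^d \text{ SFT } X, \text{ with some finite alphabet } A, \text{ which has more than one measure of maximal entropy and satisfies } h(X)\ge\log|A|-\alpha\}.$$ For a positive integer $M$, the iceberg model $\mathcal{I}_M$ is the nearest neighbor $\mathbb{Z}^2$ SFT with alphabet $\{-M,\dots,-1,1,\dots,M\}$ in which two letters may occupy adjacent sites if and only if they have the same sign or they are $1$ and $-1$ (in either order). **Theorem.** The set defining $\alpha_2$ is nonempty and bounded below, and $\alpha_2<\log 2$; more precisely, $$\alpha_2\le\log 2-\frac{\log 2}{5\cdot 10^{20}}.$$ Moreover, $h(\mathcal{I}_M)\ge\log M+\dfrac{\log 2}{5M^5}$ for every integer $M\ge1$, and $\mathcal{I}_M$ has at least two distinct measures of maximal entropy for every integer $M>4e\cdot 28^2$ (in particular for $M=10^4$). -/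

import Mathlib

open Filter Topology MeasureTheory SymbolicDynamics.FullShift

noncomputable section

/-- The nearest neighbor `ℤ^d` shift of finite type over the alphabet `A` whose forbidden
configurations are the pairs of adjacent letters `F i ⊆ A^{0, e_i}`: the pair `(a, b) ∈ F i` must
not be seen at the sites `t, t + e_i`, for any `t`. -/
def nearestNeighborSFT {d : ℕ} {A : Type} [TopologicalSpace A] [DiscreteTopology A]
    (F : Fin d → Set (A × A)) : Subshift A (Fin d → ℤ) where
  carrier := {x | ∀ (i : Fin d) (t : Fin d → ℤ), (x t, x (t + Pi.single i 1)) ∉ F i}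
  isClosed := by
    simp only [Set.ofPred_forall]
    refine isClosed_iInter fun i => isClosed_iInter fun t => ?_
    have hc : Continuous fun x : (Fin d → ℤ) → A => (x t, x (t + Pi.single i 1)) := by fun_prop
    exact (isClosed_discrete (F i)ᶜ).preimage hc
  mapsTo := by
    intro t x hx i s
    have h := hx i (t + s)
    rw [add_assoc] at h
    exact h

/-- The box `[1, n_1] × ⋯ × [1, n_d]`. -/
def box {d : ℕ} (n : Fin d → ℕ) : Finset (Fin d → ℤ) :=
  Fintype.piFinset fun i => Finset.Icc (1 : ℤ) (n i)

/-- `L_S(X)`: the configurations of shape `S` that appear in points of `X`. -/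
def languageOfShape {d : ℕ} {A : Type} [TopologicalSpace A] (X : Subshift A (Fin d → ℤ))
    (S : Finset (Fin d → ℤ)) : Set (S → A) :=
  S.restrict '' X.carrier

/-- `h` is the topological entropy of `X`: the limit, as `n_1, …, n_d → ∞`, of
`log |L_{[1,n_1] × ⋯ × [1,n_d]}(X)| / (n_1 ⋯ n_d)` exists and equals `h`. -/
def HasTopologicalEntropy {d : ℕ} {A : Type} [TopologicalSpace A]
    (X : Subshift A (Fin d → ℤ)) (h : ℝ) : Prop :=
  Tendsto (fun n : Fin d → ℕ =>
    Real.log ((languageOfShape X (box n)).ncard : ℝ) / ∏ i, (n i : ℝ)) atTop (𝓝 h)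

/-- `h` is the measure-theoretic entropy of `μ`: the limit, as `n_1, …, n_d → ∞`, of
`-∑_w μ([w]) log μ([w]) / (n_1 ⋯ n_d)`, with `w` running over the configurations of shape
`[1,n_1] × ⋯ × [1,n_d]`, exists and equals `h` (here `Real.negMulLog p = -p log p`, which is `0`
for `p = 0`). -/
def HasMeasureEntropy {d : ℕ} {A : Type} [Fintype A] [MeasurableSpace A]
    (μ : Measure ((Fin d → ℤ) → A)) (h : ℝ) : Prop :=
  Tendsto (fun n : Fin d → ℕ =>
    (∑ w : box n → A, Real.negMulLog (μ.real {x | (box n).restrict x = w})) / ∏ i, (n i : ℝ))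
    atTop (𝓝 h)

/-- `μ` is a measure of maximal entropy on `X`: a shift-invariant Borel probability measure on the
full shift, with support contained in `X`, whose entropy equals the topological entropy of `X`. -/
structure IsMeasureOfMaximalEntropy {d : ℕ} {A : Type} [Fintype A] [TopologicalSpace A]
    [MeasurableSpace A] (X : Subshift A (Fin d → ℤ)) (μ : Measure ((Fin d → ℤ) → A)) : Prop where
  isProbabilityMeasure : IsProbabilityMeasure μ
  shift_invariant : ∀ t : Fin d → ℤ, MeasurePreserving (shift t) μ μ
  support_subset : μ.support ⊆ X.carrier
  entropy_eq : ∃ h : ℝ, HasTopologicalEntropy X h ∧ HasMeasureEntropy μ h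

/-- `X` has more than one measure of maximal entropy. -/
def HasMultipleMME {d : ℕ} {A : Type} [Fintype A] [TopologicalSpace A] [MeasurableSpace A]
    (X : Subshift A (Fin d → ℤ)) : Prop :=
  ∃ μ ν : Measure ((Fin d → ℤ) → A),
    IsMeasureOfMaximalEntropy X μ ∧ IsMeasureOfMaximalEntropy X ν ∧ μ ≠ ν

/-- The set of all real `α` such that some (nonempty) nearest neighbor `ℤ^d` shift of finite type
`X`, over a finite (discrete) alphabet `A`, has more than one measure of maximal entropy and
satisfies `h(X) ≥ log |A| - α`. -/
def alphaSet (d : ℕ) : Set ℝ :=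
  {α | ∃ (A : Type) (_ : Fintype A) (_ : TopologicalSpace A) (_ : DiscreteTopology A)
      (_ : MeasurableSpace A) (_ : BorelSpace A) (F : Fin d → Set (A × A)),
      (nearestNeighborSFT F).carrier.Nonempty ∧
      HasMultipleMME (nearestNeighborSFT F) ∧
      ∃ h : ℝ, HasTopologicalEntropy (nearestNeighborSFT F) h ∧
        h ≥ Real.log (Fintype.card A : ℝ) - α}

/-- `α_d`, the infimum of the above set. -/
def alpha (d : ℕ) : ℝ := sInf (alphaSet d)

/-- The alphabet `{-M, …, -1, 1, …, M}`. -/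
abbrev IcebergAlphabet (M : ℕ) : Type :=
  {a : ℤ // a ∈ (Finset.Icc (-(M : ℤ)) (M : ℤ)).erase 0}

/-- Letters that may be adjacent in the iceberg model: letters of the same sign, and `1` and `-1`
(in either order). -/
def icebergAllowed (a b : ℤ) : Prop :=
  (0 < a ∧ 0 < b) ∨ (a < 0 ∧ b < 0) ∨ (a = 1 ∧ b = -1) ∨ (a = -1 ∧ b = 1)

/-- The iceberg model `I_M`, a nearest neighbor `ℤ^2` shift of finite type. -/
def iceberg (M : ℕ) : Subshift (IcebergAlphabet M) (Fin 2 → ℤ) :=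
  nearestNeighborSFT fun _ => {p | ¬ icebergAllowed p.1 p.2}

end

/-!
On the torus `(ℤ/N)^d` take the uniform measure on a translation invariant set of at least
`exp (h(X) N^d - o(N^d))` legal configurations. Along a subsequence these measures converge weakly,
by compactness, to a shift-invariant measure on `X`, and subadditivity of Shannon entropy under
tilings by boxes shows that the limit has maximal entropy.

In the iceberg model, every pattern of side `m` can be surrounded by layers of letters `±1` and `1`
so that it has a plus boundary condition. A Peierls argument bounds the proportion of these
configurations with a negative letter at a given site: the letters on the contour around that site
are all `±1`, and after the signs inside the contour are reversed its letters can be chosen freely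
in `{1, …, M}`, so that each site of the contour gains a factor `M`, while the contours are counted
by walks with king moves. Hence a positive proportion of the configurations are mostly positive;
they fit on the torus, and so do their negatives, which gives two different measures of maximal
entropy.

For the entropy bound, tile the plane by crosses of five sites. On each cross the `M ^ 5` positive
patterns and the pattern with `-1` surrounded by `1`s can be placed independently.
-/

section Entropy

theorem sum_negMulLog_le_sum_mul_neg_log {ι : Type*} {s : Finset ι} {p q : ι → ℝ}
    (hp : ∀ i ∈ s, 0 ≤ p i) (hq : ∀ i ∈ s, 0 < q i) (hqp : ∑ i ∈ s, q i ≤ ∑ i ∈ s, p i) :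
    ∑ i ∈ s, Real.negMulLog (p i) ≤ ∑ i ∈ s, p i * -Real.log (q i) := by
  have pointwise : ∀ i ∈ s, Real.negMulLog (p i) ≤ p i * -Real.log (q i) + (q i - p i) := by
    intro i hi
    have hqi := hq i hi
    have hle := mul_le_mul_of_nonneg_left
      (Real.negMulLog_le_one_sub_self (div_nonneg (hp i hi) hqi.le)) hqi.le
    rcases (hp i hi).eq_or_lt with hpi | hpi
    · simpa [← hpi] using hqi.le
    · rw [Real.negMulLog, Real.log_div hpi.ne' hqi.ne'] at hle
      rw [Real.negMulLog]
      field_simp at hle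
      linarith
  have hsum := Finset.sum_le_sum pointwise
  rw [Finset.sum_add_distrib, Finset.sum_sub_distrib] at hsum
  linarith

theorem sum_negMulLog_le_log_card {ι : Type*} {s : Finset ι} {p : ι → ℝ}
    (hp : ∀ i ∈ s, 0 ≤ p i) (hsum : ∑ i ∈ s, p i = 1) :
    ∑ i ∈ s, Real.negMulLog (p i) ≤ Real.log s.card := by
  have hs : (0 : ℝ) < s.card := by
    rw [Nat.cast_pos, Finset.card_pos]
    by_contra hs
    simp [Finset.not_nonempty_iff_eq_empty.1 hs] at hsum
  have gibbs := sum_negMulLog_le_sum_mul_neg_log (q := fun _ => (s.card : ℝ)⁻¹) hp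
    (fun _ _ => inv_pos.2 hs) (by simp [hsum, hs.ne'])
  simpa [← Finset.sum_mul, hsum] using gibbs

variable {α β : Type*} [Fintype β]

open scoped Classical in
/-- The Shannon entropy of the random variable `f` under the uniform distribution on `E`. -/
noncomputable def uniformEntropy (E : Finset α) (f : α → β) : ℝ :=
  ∑ y, Real.negMulLog ((E.filter (f · = y)).card / E.card)

open scoped Classical in
theorem uniformEntropy_eq_sum (E : Finset α) (f : α → β) :
    uniformEntropy E f =
      ∑ a ∈ E, (E.card : ℝ)⁻¹ * -Real.log ((E.filter (f · = f a)).card / E.card) := by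
  rw [uniformEntropy, ← Finset.sum_fiberwise_of_maps_to fun a _ => Finset.mem_univ (f a)]
  refine Finset.sum_congr rfl fun y _ => ?_
  have fiber_term : ∀ a ∈ E.filter (f · = y),
      (E.card : ℝ)⁻¹ * -Real.log ((E.filter (f · = f a)).card / E.card)
        = (E.card : ℝ)⁻¹ * -Real.log ((E.filter (f · = y)).card / E.card) := by
    intro a ha
    rw [(Finset.mem_filter.1 ha).2]
  rw [Finset.sum_congr rfl fiber_term, Finset.sum_const, nsmul_eq_mul, Real.negMulLog]
  ring

/-- Subadditivity of the entropy: Gibbs' inequality compares the uniform distribution on `E` with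
the product of the distributions of the `f j`. -/
theorem log_card_le_sum_uniformEntropy {ι : Type*} [Fintype ι] {E : Finset α} (hE : E.Nonempty)
    (f : ι → α → β) (hf : Set.InjOn (fun a j => f j a) E) :
    Real.log E.card ≤ ∑ j, uniformEntropy E (f j) := by
  classical
  have hc : (0 : ℝ) < E.card := by exact_mod_cast hE.card_pos
  let c : ι → β → ℝ := fun j y => (E.filter (f j · = y)).card / E.card
  have c_pos : ∀ j, ∀ a ∈ E, 0 < c j (f j a) := fun j a ha =>
    div_pos (Nat.cast_pos.2 (Finset.card_pos.2 ⟨a, by simp [ha]⟩)) hc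
  have c_sum : ∀ j, ∑ y, c j y = 1 := by
    intro j
    rw [← Finset.sum_div, ← Nat.cast_sum,
      ← Finset.card_eq_sum_card_fiberwise fun a _ => Finset.mem_coe.2 (Finset.mem_univ (f j a))]
    exact div_self hc.ne'
  have prod_sum_le : ∑ a ∈ E, ∏ j, c j (f j a) ≤ 1 := calc
    ∑ a ∈ E, ∏ j, c j (f j a) = ∑ p ∈ E.image fun a j => f j a, ∏ j, c j (p j) :=
      (Finset.sum_image (f := fun p : ι → β => ∏ j, c j (p j)) hf).symm
    _ ≤ ∑ p : ι → β, ∏ j, c j (p j) :=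
      Finset.sum_le_univ_sum_of_nonneg fun p => Finset.prod_nonneg fun j _ => by positivity
    _ = 1 := by simp [← Fintype.piFinset_univ, ← Finset.prod_univ_sum, c_sum]
  have gibbs := sum_negMulLog_le_sum_mul_neg_log (s := E) (p := fun _ => (E.card : ℝ)⁻¹)
    (q := fun a => ∏ j, c j (f j a)) (fun _ _ => by positivity)
    (fun a ha => Finset.prod_pos fun j _ => c_pos j a ha) (by simpa [hc.ne'] using prod_sum_le)
  calc Real.log E.card = ∑ _a ∈ E, Real.negMulLog (E.card : ℝ)⁻¹ := by
        simp [Real.negMulLog, hc.ne']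
    _ ≤ ∑ a ∈ E, (E.card : ℝ)⁻¹ * -Real.log (∏ j, c j (f j a)) := gibbs
    _ = ∑ a ∈ E, ∑ j, (E.card : ℝ)⁻¹ * -Real.log (c j (f j a)) := by
        refine Finset.sum_congr rfl fun a ha => ?_
        rw [Real.log_prod fun j _ => (c_pos j a ha).ne', ← Finset.sum_neg_distrib, Finset.mul_sum]
    _ = ∑ j, uniformEntropy E (f j) := by
        rw [Finset.sum_comm]
        exact Finset.sum_congr rfl fun j _ => (uniformEntropy_eq_sum E (f j)).symm

end Entropy
section Boxes

variable {ι : Type*}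

theorem tendsto_natCast_apply_atTop (i : ι) :
    Tendsto (fun n : ι → ℕ => (n i : ℝ)) atTop atTop :=
  tendsto_natCast_atTop_atTop.comp <| tendsto_atTop.2 fun b =>
    (eventually_ge_atTop fun _ => b).mono fun _ hn => hn i

theorem eventually_forall_pos : ∀ᶠ n : ι → ℕ in atTop, ∀ i, 0 < n i :=
  (eventually_ge_atTop 1).mono fun _ hn => hn

theorem tendsto_const_atTop_pi [Finite ι] : Tendsto (fun (k : ℕ) (_ : ι) => k) atTop atTop :=
  tendsto_atTop.2 fun b => eventually_all.2 fun i => eventually_ge_atTop (b i)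

variable [Fintype ι]

/-- The number of translates of a box of side lengths `m` that suffice to cover a box of side
lengths `n`. -/
def tileCount (n m : ι → ℕ) : ℕ := ∏ i, (n i / m i + 1)

theorem tendsto_tileCount_div (m : ι → ℕ) :
    Tendsto (fun n : ι → ℕ => (tileCount n m : ℝ) / ∏ i, (n i : ℝ)) atTop
      (𝓝 (∏ i, (m i : ℝ))⁻¹) := by
  have factor (i : ι) : Tendsto (fun n : ι → ℕ => (((n i / m i : ℕ) : ℝ) + 1) / n i) atTop
      (𝓝 (m i : ℝ)⁻¹) := by
    have hfloor := (tendsto_nat_floor_mul_div_atTop (inv_nonneg.2 (Nat.cast_nonneg (m i)))).comp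
      (tendsto_natCast_apply_atTop i)
    have hone := (tendsto_natCast_apply_atTop i).inv_tendsto_atTop
    refine (add_zero (m i : ℝ)⁻¹ ▸ hfloor.add hone).congr fun n => ?_
    simp only [Function.comp_apply, Pi.inv_apply, inv_mul_eq_div, Nat.floor_div_eq_div]
    ring
  simpa only [tileCount, Nat.cast_prod, Nat.cast_add, Nat.cast_one, Finset.prod_div_distrib,
    Finset.prod_inv_distrib] using tendsto_finsetProd _ fun i _ => factor i

/-- Fekete's lemma for functions of several variables. -/
theorem exists_tendsto_div_prod {a : (ι → ℕ) → ℝ} (ha : ∀ n, 0 ≤ a n)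
    (ha_tile : ∀ n m, (∀ i, 0 < m i) → a n ≤ tileCount n m * a m) :
    ∃ h, Tendsto (fun n => a n / ∏ i, (n i : ℝ)) atTop (𝓝 h) ∧
      ∀ m, (∀ i, 0 < m i) → h ≤ a m / ∏ i, (m i : ℝ) := by
  let rate : {m : ι → ℕ // ∀ i, 0 < m i} → ℝ := fun m => a m / ∏ i, (m.1 i : ℝ)
  have : Nonempty {m : ι → ℕ // ∀ i, 0 < m i} := ⟨⟨fun _ => 1, fun _ => one_pos⟩⟩
  have rate_bddBelow : BddBelow (Set.range rate) :=
    ⟨0, Set.forall_mem_range.2 fun m => div_nonneg (ha m) (by positivity)⟩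
  have iInf_le : ∀ m, (∀ i, 0 < m i) → iInf rate ≤ a m / ∏ i, (m i : ℝ) :=
    fun m hm => ciInf_le rate_bddBelow ⟨m, hm⟩
  refine ⟨iInf rate, tendsto_order.2 ⟨fun c hc => ?_, fun c hc => ?_⟩, iInf_le⟩
  · filter_upwards [eventually_forall_pos] with n hn using hc.trans_le (iInf_le n hn)
  · obtain ⟨⟨m, hm⟩, hmc⟩ := exists_lt_of_ciInf_lt hc
    have hlim : Tendsto (fun n : ι → ℕ => tileCount n m / (∏ i, (n i : ℝ)) * a m) atTop
        (𝓝 (a m / ∏ i, (m i : ℝ))) := by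
      simpa only [div_eq_inv_mul] using (tendsto_tileCount_div m).mul_const (a m)
    filter_upwards [hlim.eventually_lt_const hmc] with n hn
    refine lt_of_le_of_lt ?_ hn
    rw [div_mul_eq_mul_div]
    exact div_le_div_of_nonneg_right (ha_tile n m hm) (by positivity)

end Boxes

section TopologicalEntropy

variable {d : ℕ} {A : Type}

theorem mem_box {n : Fin d → ℕ} {p : Fin d → ℤ} : p ∈ box n ↔ ∀ i, 1 ≤ p i ∧ p i ≤ n i := by
  simp [box, Fintype.mem_piFinset]

/-- The corner `(j_i m_i)_i` of the tile of index `j` in the tiling of `ℤ^d` by translates of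
`box m`. -/
def tileCorner {n : Fin d → ℕ} (m : Fin d → ℕ) (j : (i : Fin d) → Fin (n i / m i + 1)) :
    Fin d → ℤ :=
  fun i => (j i : ℕ) * (m i : ℤ)

theorem exists_eq_tileCorner_add {n m : Fin d → ℕ} (hm : ∀ i, 0 < m i) {p : Fin d → ℤ}
    (hp : p ∈ box n) :
    ∃ j : (i : Fin d) → Fin (n i / m i + 1), ∃ q ∈ box m, p = tileCorner m j + q := by
  rw [mem_box] at hp
  have hm' : ∀ i, (0 : ℤ) < m i := fun i => by exact_mod_cast hm i
  have quot_nonneg : ∀ i, 0 ≤ (p i - 1) / (m i : ℤ) := fun i =>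
    Int.ediv_nonneg (by have := (hp i).1; lia) (hm' i).le
  refine ⟨fun i => ⟨((p i - 1) / m i).toNat, ?_⟩, fun i => (p i - 1) % m i + 1, ?_, ?_⟩
  · have quot_le : (p i - 1) / (m i : ℤ) ≤ ((n i / m i : ℕ) : ℤ) := by
      rw [Int.natCast_div]
      exact Int.ediv_le_ediv (hm' i) (by have := (hp i).2; lia)
    lia
  · refine mem_box.2 fun i => ?_
    have := Int.emod_nonneg (p i - 1) (hm' i).ne'
    have := Int.emod_lt_of_pos (p i - 1) (hm' i)
    constructor <;> lia
  · funext i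
    have := Int.mul_ediv_add_emod (p i - 1) (m i)
    simp only [tileCorner, Pi.add_apply, Int.toNat_of_nonneg (quot_nonneg i)]
    linarith

variable [Finite A] [TopologicalSpace A]

theorem ncard_languageOfShape_pos {X : Subshift A (Fin d → ℤ)} (hX : X.carrier.Nonempty)
    (S : Finset (Fin d → ℤ)) : 0 < (languageOfShape X S).ncard :=
  (Set.ncard_pos (Set.toFinite _)).2 (hX.image _)

theorem ncard_languageOfShape_le (X : Subshift A (Fin d → ℤ)) (n : Fin d → ℕ) {m : Fin d → ℕ}
    (hm : ∀ i, 0 < m i) :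
    (languageOfShape X (box n)).ncard ≤ (languageOfShape X (box m)).ncard ^ tileCount n m := by
  choose x hxX hxw using fun w : languageOfShape X (box n) => w.2
  let tiles : languageOfShape X (box n) →
      ((i : Fin d) → Fin (n i / m i + 1)) → languageOfShape X (box m) := fun w j =>
    ⟨(box m).restrict (shift (tileCorner m j) (x w)),
      Set.mem_image_of_mem _ (X.mapsTo _ (hxX w))⟩
  have tiles_injective : Function.Injective tiles := by
    intro v w h
    apply Subtype.ext
    rw [← hxw v, ← hxw w]
    funext ⟨p, hp⟩
    obtain ⟨j, q, hq, rfl⟩ := exists_eq_tileCorner_add hm hp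
    simpa [tiles] using congrFun (congrArg Subtype.val (congrFun h j)) ⟨q, hq⟩
  simpa [tileCount, Nat.card_pi, Nat.card_coe_set_eq, Nat.card_fun]
    using Nat.card_le_card_of_injective tiles tiles_injective

theorem log_ncard_languageOfShape_le (X : Subshift A (Fin d → ℤ)) (n : Fin d → ℕ) {m : Fin d → ℕ}
    (hm : ∀ i, 0 < m i) :
    Real.log (languageOfShape X (box n)).ncard
      ≤ tileCount n m * Real.log (languageOfShape X (box m)).ncard := by
  rcases Nat.eq_zero_or_pos (languageOfShape X (box n)).ncard with h | h
  · rw [h, Nat.cast_zero, Real.log_zero]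
    exact mul_nonneg (Nat.cast_nonneg _) (Real.log_natCast_nonneg _)
  · rw [← Real.log_pow]
    exact Real.log_le_log (by exact_mod_cast h) (by exact_mod_cast ncard_languageOfShape_le X n hm)

theorem exists_hasTopologicalEntropy (X : Subshift A (Fin d → ℤ)) :
    ∃ h, HasTopologicalEntropy X h ∧ ∀ m : Fin d → ℕ, (∀ i, 0 < m i) →
      h ≤ Real.log (languageOfShape X (box m)).ncard / ∏ i, (m i : ℝ) :=
  exists_tendsto_div_prod (fun _ => Real.log_natCast_nonneg _)
    fun n _ hm => log_ncard_languageOfShape_le X n hm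

end TopologicalEntropy
section Torus

variable {d N : ℕ} {A : Type}

/-- The reduction `ℤ^d → (ℤ/N)^d`. -/
def toTorus (N : ℕ) (t : Fin d → ℤ) : Fin d → ZMod N := fun i => t i

theorem toTorus_zero : toTorus N (0 : Fin d → ℤ) = 0 := funext fun _ => Int.cast_zero

theorem toTorus_add (s t : Fin d → ℤ) : toTorus N (s + t) = toTorus N s + toTorus N t :=
  funext fun _ => Int.cast_add _ _

theorem toTorus_single_one (i : Fin d) : toTorus N (Pi.single i 1) = Pi.single i 1 := by
  funext l
  rcases eq_or_ne l i with rfl | h <;> simp [toTorus, *]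

theorem exists_mem_box_toTorus_eq [NeZero N] (t : Fin d → ZMod N) :
    ∃ p ∈ box (fun _ : Fin d => N), toTorus N p = t := by
  refine ⟨fun i => ((t i - 1).val : ℤ) + 1, mem_box.2 fun i => ?_, ?_⟩
  · have := ZMod.val_lt (t i - 1)
    constructor <;> lia
  · funext i
    simp [toTorus]

/-- The periodic point of the full shift obtained by unrolling a configuration on a torus. -/
def periodicExtension (y : (Fin d → ZMod N) → A) : (Fin d → ℤ) → A := y ∘ toTorus N

theorem shift_periodicExtension (t : Fin d → ℤ) (y : (Fin d → ZMod N) → A) :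
    shift t (periodicExtension y) = periodicExtension fun s => y (toTorus N t + s) :=
  funext fun s => congrArg y (toTorus_add t s)

theorem periodicExtension_mem_nearestNeighborSFT [TopologicalSpace A] [DiscreteTopology A]
    {F : Fin d → Set (A × A)} {y : (Fin d → ZMod N) → A}
    (hy : ∀ i t, (y t, y (t + Pi.single i 1)) ∉ F i) :
    periodicExtension y ∈ (nearestNeighborSFT F).carrier := by
  intro i t
  simpa only [periodicExtension, Function.comp_apply, toTorus_add, toTorus_single_one]
    using hy i (toTorus N t)

/-- A nonempty family of configurations on the torus which is closed under translations. -/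
structure IsTorusEnsemble (E : Finset ((Fin d → ZMod N) → A)) : Prop where
  nonempty : E.Nonempty
  translate_mem : ∀ t, ∀ y ∈ E, (fun s => y (t + s)) ∈ E

open scoped Classical in
theorem IsTorusEnsemble.card_filter_translate {E : Finset ((Fin d → ZMod N) → A)}
    (hE : IsTorusEnsemble E) (t : Fin d → ZMod N) (Q : ((Fin d → ZMod N) → A) → Prop) :
    (E.filter fun y => Q fun s => y (t + s)).card = (E.filter Q).card := by
  refine Finset.card_bij' (fun y _ s => y (t + s)) (fun y _ s => y (-t + s)) ?_ ?_ ?_ ?_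
  · intro y hy
    rw [Finset.mem_filter] at hy ⊢
    exact ⟨hE.translate_mem t y hy.1, hy.2⟩
  · intro y hy
    rw [Finset.mem_filter] at hy ⊢
    exact ⟨hE.translate_mem (-t) y hy.1, by simpa using hy.2⟩
  · simp
  · simp

variable [MeasurableSpace A]

/-- The uniform distribution on the periodic points coming from `E`. -/
noncomputable def torusMeasure (E : Finset ((Fin d → ZMod N) → A)) : Measure ((Fin d → ℤ) → A) :=
  (E.card : ENNReal)⁻¹ • ∑ y ∈ E, Measure.dirac (periodicExtension y)

open scoped Classical in
theorem torusMeasure_apply (E : Finset ((Fin d → ZMod N) → A)) {S : Set ((Fin d → ℤ) → A)}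
    (hS : MeasurableSet S) :
    torusMeasure E S = (E.filter fun y => periodicExtension y ∈ S).card / E.card := by
  simp only [torusMeasure, Measure.smul_apply, Measure.finsetSum_apply, smul_eq_mul,
    Measure.dirac_apply' _ hS, Set.indicator_apply, Pi.one_apply, Finset.sum_boole]
  rw [ENNReal.div_eq_inv_mul]

open scoped Classical in
theorem torusMeasure_real_apply (E : Finset ((Fin d → ZMod N) → A)) {S : Set ((Fin d → ℤ) → A)}
    (hS : MeasurableSet S) :
    (torusMeasure E).real S = (E.filter fun y => periodicExtension y ∈ S).card / E.card := by
  simp [measureReal_def, torusMeasure_apply E hS]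

theorem torusMeasure_eq_zero {E : Finset ((Fin d → ZMod N) → A)} {S : Set ((Fin d → ℤ) → A)}
    (hS : MeasurableSet S) (h : ∀ y ∈ E, periodicExtension y ∉ S) : torusMeasure E S = 0 := by
  classical
  rw [torusMeasure_apply E hS, Finset.filter_false_of_mem h]
  simp

theorem isProbabilityMeasure_torusMeasure {E : Finset ((Fin d → ZMod N) → A)} (hE : E.Nonempty) :
    IsProbabilityMeasure (torusMeasure E) := by
  classical
  refine ⟨?_⟩
  simp only [torusMeasure_apply E MeasurableSet.univ, Set.mem_univ, Finset.filter_true]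
  exact ENNReal.div_self (by simpa using hE.ne_empty) (by simp)

theorem measurable_shift (t : Fin d → ℤ) :
    Measurable (shift t : ((Fin d → ℤ) → A) → ((Fin d → ℤ) → A)) :=
  measurable_pi_lambda _ fun _ => measurable_pi_apply _

theorem IsTorusEnsemble.measurePreserving_shift {E : Finset ((Fin d → ZMod N) → A)}
    (hE : IsTorusEnsemble E) (t : Fin d → ℤ) :
    MeasurePreserving (shift t) (torusMeasure E) (torusMeasure E) := by
  classical
  refine ⟨measurable_shift t, Measure.ext fun S hS => ?_⟩
  rw [Measure.map_apply (measurable_shift t) hS, torusMeasure_apply E hS,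
    torusMeasure_apply E (measurable_shift t hS)]
  simp only [Set.mem_preimage, shift_periodicExtension]
  rw [hE.card_filter_translate (toTorus N t) fun y => periodicExtension y ∈ S]

open scoped Classical in
theorem IsTorusEnsemble.le_torusMeasure_real_apply_zero [NeZero N]
    {E : Finset ((Fin d → ZMod N) → A)} (hE : IsTorusEnsemble E) {P : Set A}
    (hP : MeasurableSet P) {c : ℝ}
    (hc : ∀ y ∈ E, c * (N : ℝ) ^ d ≤ (Finset.univ.filter fun t => y t ∈ P).card) :
    c ≤ (torusMeasure E).real {x | x 0 ∈ P} := by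
  have hEc : (0 : ℝ) < E.card := by exact_mod_cast hE.nonempty.card_pos
  have hN : (0 : ℝ) < (N : ℝ) ^ d := by
    have : (0 : ℝ) < N := by exact_mod_cast NeZero.pos N
    positivity
  have stationary : ∀ t : Fin d → ZMod N,
      (E.filter fun y => y t ∈ P).card = (E.filter fun y => y 0 ∈ P).card := fun t => by
    simpa using hE.card_filter_translate t fun y => y 0 ∈ P
  have double_count : ∑ y ∈ E, (Finset.univ.filter fun t => y t ∈ P).card
      = N ^ d * (E.filter fun y => y 0 ∈ P).card := calc
    _ = ∑ t : Fin d → ZMod N, (E.filter fun y => y t ∈ P).card := by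
      simp only [Finset.card_filter]
      exact Finset.sum_comm
    _ = N ^ d * (E.filter fun y => y 0 ∈ P).card := by simp [stationary]
  have hsum := Finset.sum_le_sum hc
  rw [Finset.sum_const, nsmul_eq_mul, ← Nat.cast_sum, double_count] at hsum
  push_cast at hsum
  have hS : MeasurableSet {x : (Fin d → ℤ) → A | x 0 ∈ P} := measurable_pi_apply _ hP
  rw [torusMeasure_real_apply E hS, le_div_iff₀ hEc]
  simp only [Set.mem_ofPred_eq, periodicExtension, Function.comp_apply, toTorus_zero]
  refine le_of_mul_le_mul_left ?_ hN
  linarith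

end Torus

section BoxEntropy

theorem measurableSet_restrict_eq {G A : Type*} [MeasurableSpace A] [MeasurableSingletonClass A]
    (S : Finset G) (w : S → A) : MeasurableSet {x : G → A | S.restrict x = w} :=
  (Finset.measurable_restrict (X := fun _ => A) S) (measurableSet_singleton w)

variable {d N : ℕ} {A : Type} [Fintype A] [MeasurableSpace A]

/-- The entropy of the distribution, under `μ`, of the restriction to `box m`. -/
noncomputable def boxEntropy (μ : Measure ((Fin d → ℤ) → A)) (m : Fin d → ℕ) : ℝ :=
  ∑ w : box m → A, Real.negMulLog (μ.real {x | (box m).restrict x = w})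

variable [MeasurableSingletonClass A]

theorem boxEntropy_le_log_ncard [TopologicalSpace A] {X : Subshift A (Fin d → ℤ)}
    {μ : Measure ((Fin d → ℤ) → A)} [IsProbabilityMeasure μ] (hX : μ X.carrierᶜ = 0)
    (m : Fin d → ℕ) : boxEntropy μ m ≤ Real.log (languageOfShape X (box m)).ncard := by
  classical
  have null : ∀ w ∉ languageOfShape X (box m), μ.real {x | (box m).restrict x = w} = 0 := by
    intro w hw
    have : μ {x | (box m).restrict x = w} = 0 :=
      measure_mono_null (fun x hx hxX => hw ⟨x, hxX, hx⟩) hX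
    simp [measureReal_def, this]
  have total : ∑ w : box m → A, μ.real {x | (box m).restrict x = w} = 1 := by
    simpa [Set.preimage] using sum_measureReal_preimage_singleton (μ := μ)
      (f := (box m).restrict (π := fun _ => A)) Finset.univ
      fun w _ => measurableSet_restrict_eq (box m) w
  have hsub := Finset.subset_univ (languageOfShape X (box m)).toFinset
  rw [← Finset.sum_subset hsub fun w _ hw => null w (by simpa using hw)] at total
  rw [boxEntropy, ← Finset.sum_subset hsub fun w _ hw => by simp [null w (by simpa using hw)],
    Set.ncard_eq_toFinset_card']
  exact sum_negMulLog_le_log_card (fun _ _ => measureReal_nonneg) total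

theorem IsTorusEnsemble.uniformEntropy_eq_boxEntropy {E : Finset ((Fin d → ZMod N) → A)}
    (hE : IsTorusEnsemble E) (m : Fin d → ℕ) (t : Fin d → ℤ) :
    uniformEntropy E (fun y => (box m).restrict (shift t (periodicExtension y)))
      = boxEntropy (torusMeasure E) m := by
  classical
  refine Finset.sum_congr rfl fun w _ => ?_
  have hS := measurableSet_restrict_eq (box m) w
  rw [← (hE.measurePreserving_shift t).measureReal_preimage hS.nullMeasurableSet,
    torusMeasure_real_apply E (measurable_shift t hS)]
  simp only [Set.mem_preimage, Set.mem_ofPred_eq]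

theorem IsTorusEnsemble.log_card_le [NeZero N] {E : Finset ((Fin d → ZMod N) → A)}
    (hE : IsTorusEnsemble E) {m : Fin d → ℕ} (hm : ∀ i, 0 < m i) :
    Real.log E.card ≤ tileCount (fun _ : Fin d => N) m * boxEntropy (torusMeasure E) m := by
  have tiles_injOn : Set.InjOn (fun (y : (Fin d → ZMod N) → A)
      (j : (i : Fin d) → Fin (N / m i + 1)) =>
        (box m).restrict (shift (tileCorner m j) (periodicExtension y))) E := by
    intro y _ z _ h
    funext t
    obtain ⟨p, hp, rfl⟩ := exists_mem_box_toTorus_eq t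
    obtain ⟨j, q, hq, rfl⟩ := exists_eq_tileCorner_add hm hp
    exact congrFun (congrFun h j) ⟨q, hq⟩
  simpa [hE.uniformEntropy_eq_boxEntropy, tileCount]
    using log_card_le_sum_uniformEntropy hE.nonempty _ tiles_injOn

end BoxEntropy
section WeakLimits

variable {Ω ι : Type*} [MeasurableSpace Ω] [TopologicalSpace Ω] [HasOuterApproxClosed Ω]
  {l : Filter ι} {ν : ι → ProbabilityMeasure Ω} {μ : ProbabilityMeasure Ω}

theorem measurePreserving_of_tendsto [BorelSpace Ω] [l.NeBot] (h : Tendsto ν l (𝓝 μ)) {f : Ω → Ω}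
    (hf : Continuous f) (hν : ∀ i, MeasurePreserving f (ν i : Measure Ω) (ν i)) :
    MeasurePreserving f (μ : Measure Ω) μ := by
  have hmap := ProbabilityMeasure.tendsto_map_of_tendsto_of_continuous ν μ h hf
  have map_eq : (fun i => (ν i).map hf.measurable.aemeasurable) = ν :=
    funext fun i => Subtype.ext (hν i).map_eq
  rw [map_eq] at hmap
  exact ⟨hf.measurable, congrArg ProbabilityMeasure.toMeasure (tendsto_nhds_unique hmap h)⟩

variable [OpensMeasurableSpace Ω]

theorem measure_eq_zero_of_tendsto [l.NeBot] (h : Tendsto ν l (𝓝 μ)) {G : Set Ω} (hG : IsOpen G)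
    (hν : ∀ i, (ν i : Measure Ω) G = 0) : (μ : Measure Ω) G = 0 := by
  simpa [hν] using ProbabilityMeasure.le_liminf_measure_open_of_tendsto h hG

theorem tendsto_measureReal_of_isClopen (h : Tendsto ν l (𝓝 μ)) {S : Set Ω} (hS : IsClopen S) :
    Tendsto (fun i => (ν i : Measure Ω).real S) l (𝓝 ((μ : Measure Ω).real S)) :=
  (ENNReal.tendsto_toReal (measure_ne_top _ _)).comp <|
    ProbabilityMeasure.tendsto_measure_of_null_frontier_of_tendsto' h (by simp [hS.frontier_eq])

end WeakLimits

section MaximalEntropy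

variable {d : ℕ} {A : Type} [Fintype A] [TopologicalSpace A] [MeasurableSpace A]

theorem isMeasureOfMaximalEntropy_of_le_boxEntropy [MeasurableSingletonClass A]
    {X : Subshift A (Fin d → ℤ)} {h : ℝ} (hh : HasTopologicalEntropy X h)
    {μ : Measure ((Fin d → ℤ) → A)} [IsProbabilityMeasure μ]
    (hinv : ∀ t : Fin d → ℤ, MeasurePreserving (shift t) μ μ) (hX : μ X.carrierᶜ = 0)
    (hlow : ∀ m : Fin d → ℕ, (∀ i, 0 < m i) → h ≤ boxEntropy μ m / ∏ i, (m i : ℝ)) :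
    IsMeasureOfMaximalEntropy X μ where
  isProbabilityMeasure := inferInstance
  shift_invariant := hinv
  support_subset := Measure.support_subset_of_isClosed X.isClosed (mem_ae_iff.2 hX)
  entropy_eq := by
    refine ⟨h, hh, tendsto_of_tendsto_of_tendsto_of_le_of_le' tendsto_const_nhds hh
      (eventually_forall_pos.mono hlow) (Eventually.of_forall fun m => ?_)⟩
    exact div_le_div_of_nonneg_right (boxEntropy_le_log_ncard hX m) (by positivity)

variable [DiscreteTopology A] [BorelSpace A]

theorem tendsto_boxEntropy {ι : Type*} {l : Filter ι}
    {ν : ι → ProbabilityMeasure ((Fin d → ℤ) → A)} {μ : ProbabilityMeasure ((Fin d → ℤ) → A)}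
    (h : Tendsto ν l (𝓝 μ)) (m : Fin d → ℕ) :
    Tendsto (fun i => boxEntropy (ν i : Measure ((Fin d → ℤ) → A)) m) l
      (𝓝 (boxEntropy (μ : Measure ((Fin d → ℤ) → A)) m)) := by
  refine tendsto_finsetSum _ fun w _ => (Real.continuous_negMulLog.tendsto _).comp ?_
  refine tendsto_measureReal_of_isClopen h ((isClopen_discrete {w}).preimage ?_)
  exact (by fun_prop : Continuous ((box m).restrict (π := fun _ => A)))

/-- Dividing `log |E k| ≤ tileCount N_k m * H_m(ν k)` by `N_k ^ d` and letting `k → ∞` turns the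
growth rate of the ensembles into a lower bound for the box entropies of the limit. -/
theorem le_boxEntropy_div_of_tendsto_torusMeasure {l : Filter ℕ} [l.NeBot] {N : ℕ → ℕ}
    [∀ k, NeZero (N k)] (hN : Tendsto N l atTop) {E : ∀ k, Finset ((Fin d → ZMod (N k)) → A)}
    (hE : ∀ k, IsTorusEnsemble (E k)) {ν : ℕ → ProbabilityMeasure ((Fin d → ℤ) → A)}
    (hν : ∀ k, (ν k : Measure ((Fin d → ℤ) → A)) = torusMeasure (E k))
    {μ : ProbabilityMeasure ((Fin d → ℤ) → A)} (hμ : Tendsto ν l (𝓝 μ)) {g : ℕ → ℝ} {h : ℝ}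
    (hg : Tendsto g l (𝓝 h)) (hcard : ∀ k, g k * (N k : ℝ) ^ d ≤ Real.log (E k).card)
    {m : Fin d → ℕ} (hm : ∀ i, 0 < m i) :
    h ≤ boxEntropy (μ : Measure ((Fin d → ℤ) → A)) m / ∏ i, (m i : ℝ) := by
  have htile := (tendsto_tileCount_div m).comp (tendsto_const_atTop_pi.comp hN)
  rw [div_eq_inv_mul]
  refine le_of_tendsto_of_tendsto' hg (htile.mul (tendsto_boxEntropy hμ m)) fun k => ?_
  have hNk : (0 : ℝ) < (N k : ℝ) ^ d := pow_pos (Nat.cast_pos.2 (NeZero.pos (N k))) d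
  simp only [Function.comp_apply, Finset.prod_const, Finset.card_univ, Fintype.card_fin, hν,
    div_mul_eq_mul_div]
  exact (le_div_iff₀ hNk).2 ((hcard k).trans ((hE k).log_card_le hm))

open scoped Classical in
/-- Weak limits of the uniform measures on torus ensembles whose growth rate is the topological
entropy have maximal entropy and inherit lower bounds on the density of a set of letters. -/
theorem exists_isMeasureOfMaximalEntropy_of_torus {F : Fin d → Set (A × A)} {h : ℝ}
    (hh : HasTopologicalEntropy (nearestNeighborSFT F) h) {N : ℕ → ℕ} [∀ k, NeZero (N k)]
    (hN : Tendsto N atTop atTop) {E : ∀ k, Finset ((Fin d → ZMod (N k)) → A)}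
    (hE : ∀ k, IsTorusEnsemble (E k))
    (hlegal : ∀ k, ∀ y ∈ E k, ∀ i t, (y t, y (t + Pi.single i 1)) ∉ F i)
    {g : ℕ → ℝ} (hg : Tendsto g atTop (𝓝 h))
    (hcard : ∀ k, g k * (N k : ℝ) ^ d ≤ Real.log (E k).card) {P : Set A} {c : ℝ}
    (hP : ∀ k, ∀ y ∈ E k, c * (N k : ℝ) ^ d ≤ (Finset.univ.filter fun t => y t ∈ P).card) :
    ∃ μ : Measure ((Fin d → ℤ) → A), IsMeasureOfMaximalEntropy (nearestNeighborSFT F) μ ∧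
      c ≤ μ.real {x | x 0 ∈ P} := by
  let ν : ℕ → ProbabilityMeasure ((Fin d → ℤ) → A) := fun k =>
    ⟨torusMeasure (E k), isProbabilityMeasure_torusMeasure (hE k).nonempty⟩
  let l : Ultrafilter ℕ := hyperfilter ℕ
  have hl : (l : Filter ℕ) ≤ atTop := Nat.hyperfilter_le_atTop
  obtain ⟨μ, -, hμ : Tendsto ν l (𝓝 μ)⟩ := isCompact_univ.ultrafilter_le_nhds (l.map ν) (by simp)
  refine ⟨μ, isMeasureOfMaximalEntropy_of_le_boxEntropy hh (fun t => ?_) ?_ fun m hm => ?_, ?_⟩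
  · exact measurePreserving_of_tendsto hμ (continuous_shift t)
      fun k => (hE k).measurePreserving_shift t
  · have hX := (nearestNeighborSFT F).isClosed
    exact measure_eq_zero_of_tendsto hμ hX.isOpen_compl fun k =>
      torusMeasure_eq_zero hX.measurableSet.compl fun y hy hyX =>
        hyX (periodicExtension_mem_nearestNeighborSFT (hlegal k y hy))
  · exact le_boxEntropy_div_of_tendsto_torusMeasure (hN.mono_left hl) hE (fun _ => rfl) hμ
      (hg.mono_left hl) hcard hm
  · have hS : IsClopen {x : (Fin d → ℤ) → A | x 0 ∈ P} :=
      (isClopen_discrete P).preimage (continuous_apply (0 : Fin d → ℤ))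
    exact ge_of_tendsto' (tendsto_measureReal_of_isClopen hμ hS) fun k =>
      (hE k).le_torusMeasure_real_apply_zero (isOpen_discrete P).measurableSet (hP k)

end MaximalEntropy

section Walks

variable {G : Type*} [AddCommGroup G] [DecidableEq G]

/-- The set of sites visited by the walk with starting point `p` and steps `w`. -/
def visit : G → List G → Finset G
  | p, [] => {p}
  | p, a :: w => insert p (visit (p + a) w)

theorem mem_visit_self (p : G) (w : List G) : p ∈ visit p w := by
  cases w <;> simp [visit]

theorem visit_detour (p a : G) (w : List G) :
    visit p (a :: -a :: w) = insert (p + a) (visit p w) := by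
  simp only [visit, add_neg_cancel_right]
  rw [Finset.insert_comm, Finset.insert_eq_of_mem (mem_visit_self p w)]

theorem exists_visit_eq_insert {S : Set G} (hS : ∀ a ∈ S, -a ∈ S) {a : G} (ha : a ∈ S) {w : List G}
    (hw : ∀ b ∈ w, b ∈ S) {p q : G} (hq : q ∈ visit p w) :
    ∃ w' : List G, (∀ b ∈ w', b ∈ S) ∧ w'.length = w.length + 2 ∧
      visit p w' = insert (q + a) (visit p w) := by
  have detour (p : G) {w : List G} (hw : ∀ b ∈ w, b ∈ S) : ∃ w' : List G, (∀ b ∈ w', b ∈ S) ∧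
      w'.length = w.length + 2 ∧ visit p w' = insert (p + a) (visit p w) :=
    ⟨a :: -a :: w, by simpa [ha, hS a ha] using hw, rfl, visit_detour p a w⟩
  induction w generalizing p with
  | nil =>
    obtain rfl : q = p := by simpa [visit] using hq
    exact detour q hw
  | cons c w ih =>
    rcases Finset.mem_insert.1 hq with rfl | hq
    · exact detour q hw
    · rw [List.forall_mem_cons] at hw
      obtain ⟨w', hw', hlen, hvis⟩ := ih hw.2 hq
      refine ⟨c :: w', List.forall_mem_cons.2 ⟨hw.1, hw'⟩, by simp [hlen], ?_⟩
      simp only [visit, hvis, Finset.insert_comm]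

variable {S : Set G} {D : Finset G} {p : G}

theorem exists_visit_subset_card_eq (hS : ∀ a ∈ S, -a ∈ S) (hp : p ∈ D)
    (hconn : ∀ V ⊆ D, p ∈ V → (∀ q ∈ V, ∀ r ∈ D, r - q ∈ S → r ∈ V) → V = D) (n : ℕ)
    (hn : n + 1 ≤ D.card) :
    ∃ w : List G, (∀ a ∈ w, a ∈ S) ∧ w.length = 2 * n ∧ visit p w ⊆ D ∧
      (visit p w).card = n + 1 := by
  induction n with
  | zero => exact ⟨[], by simp, by simp, by simpa [visit] using hp, by simp [visit]⟩
  | succ n ih =>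
    obtain ⟨w, hw, hlen, hsub, hcard⟩ := ih (by lia)
    have hne : visit p w ≠ D := fun h => by rw [h] at hcard; lia
    obtain ⟨q, hq, r, hr, hqr, hrw⟩ : ∃ q ∈ visit p w, ∃ r ∈ D, r - q ∈ S ∧ r ∉ visit p w := by
      by_contra! h
      exact hne (hconn _ hsub (mem_visit_self p w) h)
    obtain ⟨w', hw', hlen', hvis⟩ := exists_visit_eq_insert hS hqr hw hq
    rw [add_sub_cancel] at hvis
    exact ⟨w', hw', by lia, hvis ▸ Finset.insert_subset hr hsub,
      by rw [hvis, Finset.card_insert_of_notMem hrw, hcard]⟩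

theorem exists_visit_eq (hS : ∀ a ∈ S, -a ∈ S) (hp : p ∈ D)
    (hconn : ∀ V ⊆ D, p ∈ V → (∀ q ∈ V, ∀ r ∈ D, r - q ∈ S → r ∈ V) → V = D) :
    ∃ w : List G, (∀ a ∈ w, a ∈ S) ∧ w.length = 2 * (D.card - 1) ∧ visit p w = D := by
  have hpos : 0 < D.card := Finset.card_pos.2 ⟨p, hp⟩
  obtain ⟨w, hw, hlen, hsub, hcard⟩ :=
    exists_visit_subset_card_eq hS hp hconn (D.card - 1) (by lia)
  exact ⟨w, hw, hlen, Finset.eq_of_subset_of_card_le hsub (by lia)⟩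

end Walks

section KingWalks

/-- Two sites of the square lattice at distance at most one in the maximum norm. -/
def KingAdj (p q : ℤ × ℤ) : Prop :=
  (p.1 ≤ q.1 + 1 ∧ q.1 ≤ p.1 + 1) ∧ (p.2 ≤ q.2 + 1 ∧ q.2 ≤ p.2 + 1)

theorem KingAdj.symm {p q : ℤ × ℤ} (h : KingAdj p q) : KingAdj q p :=
  ⟨h.1.symm, h.2.symm⟩

/-- The nine displacements of maximum norm at most one. -/
noncomputable def kingSteps : Finset (ℤ × ℤ) := Finset.Icc (-1) 1 ×ˢ Finset.Icc (-1) 1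

theorem mem_kingSteps {a : ℤ × ℤ} :
    a ∈ kingSteps ↔ (-1 ≤ a.1 ∧ a.1 ≤ 1) ∧ (-1 ≤ a.2 ∧ a.2 ≤ 1) := by
  simp only [kingSteps, Finset.mem_product, Finset.mem_Icc]

theorem card_kingSteps : kingSteps.card = 9 := by simp [kingSteps]

theorem neg_mem_kingSteps {a : ℤ × ℤ} (ha : a ∈ kingSteps) : -a ∈ kingSteps := by
  rw [mem_kingSteps] at ha ⊢
  simp only [Prod.fst_neg, Prod.snd_neg]
  lia

theorem sub_mem_kingSteps {p q : ℤ × ℤ} : q - p ∈ kingSteps ↔ KingAdj p q := by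
  simp only [mem_kingSteps, KingAdj, Prod.fst_sub, Prod.snd_sub]
  lia

theorem fst_le_of_mem_visit {w : List (ℤ × ℤ)} (hw : ∀ a ∈ w, a ∈ kingSteps) {p q : ℤ × ℤ}
    (hq : q ∈ visit p w) : q.1 ≤ p.1 + w.length := by
  induction w generalizing p with
  | nil =>
    obtain rfl : q = p := by simpa [visit] using hq
    simp
  | cons c w ih =>
    rw [List.forall_mem_cons] at hw
    rw [List.length_cons]
    rcases Finset.mem_insert.1 hq with rfl | hq
    · lia
    · have hrest := ih hw.2 hq
      have hstep := mem_kingSteps.1 hw.1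
      rw [Prod.fst_add] at hrest
      lia

/-- The sets visited by king walks of length `2 (k - 1)` that start in the row of `t`, to the left
of `t` and at distance less than `2 k`. Every contour with `k` sites around `t` is among them. -/
noncomputable def kingClusters (t : ℤ × ℤ) (k : ℕ) : Finset (Finset (ℤ × ℤ)) :=
  (Finset.range (2 * k) ×ˢ Fintype.piFinset fun _ : Fin (2 * (k - 1)) => kingSteps).image
    fun jw => visit (t.1 - jw.1, t.2) (List.ofFn jw.2)

theorem card_kingClusters_le (t : ℤ × ℤ) {k : ℕ} (hk : 1 ≤ k) :
    (kingClusters t k).card ≤ 162 ^ k := by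
  obtain ⟨j, rfl⟩ : ∃ j, k = j + 1 := ⟨k - 1, by lia⟩
  have hstart : 2 * (j + 1) ≤ 2 ^ (j + 1) := by
    have : j < 2 ^ j := Nat.lt_two_pow_self
    rw [pow_succ]
    lia
  calc (kingClusters t (j + 1)).card ≤ 2 * (j + 1) * 9 ^ (2 * j) := by
        refine Finset.card_image_le.trans_eq ?_
        simp [Finset.card_product, Fintype.card_piFinset, card_kingSteps]
    _ ≤ 2 ^ (j + 1) * 81 ^ (j + 1) := by
        rw [pow_mul]
        gcongr <;> lia
    _ = 162 ^ (j + 1) := by rw [← mul_pow]; norm_num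

theorem visit_mem_kingClusters {t : ℤ × ℤ} {k j : ℕ} (hj : j < 2 * k) {w : List (ℤ × ℤ)}
    (hw : ∀ a ∈ w, a ∈ kingSteps) (hlen : w.length = 2 * (k - 1)) :
    visit (t.1 - j, t.2) w ∈ kingClusters t k := by
  rw [kingClusters, Finset.mem_image, ← hlen]
  refine ⟨(j, fun i => w.get i), ?_, by simp⟩
  exact Finset.mem_product.2
    ⟨Finset.mem_range.2 hj, Fintype.mem_piFinset.2 fun i => hw _ (List.get_mem _ _)⟩

end KingWalks

section Contours

/-- Two sites of the square lattice joined by an edge. -/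
def LatticeAdj (p q : ℤ × ℤ) : Prop :=
  (p.2 = q.2 ∧ (q.1 = p.1 + 1 ∨ p.1 = q.1 + 1)) ∨ (p.1 = q.1 ∧ (q.2 = p.2 + 1 ∨ p.2 = q.2 + 1))

theorem LatticeAdj.symm {p q : ℤ × ℤ} (h : LatticeAdj p q) : LatticeAdj q p := by
  unfold LatticeAdj at *
  lia

theorem LatticeAdj.kingAdj {p q : ℤ × ℤ} (h : LatticeAdj p q) : KingAdj p q := by
  unfold LatticeAdj KingAdj at *
  lia

theorem KingAdj.refl (p : ℤ × ℤ) : KingAdj p p := by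
  unfold KingAdj
  lia

theorem latticeAdj_fst_succ (p : ℤ × ℤ) : LatticeAdj p (p.1 + 1, p.2) := by simp [LatticeAdj]

/-- The sites having a lattice neighbor of the opposite sign; signs are encoded in `ZMod 2`. -/
def signBoundary (s : ℤ × ℤ → ZMod 2) : Set (ℤ × ℤ) :=
  {p | ∃ q, LatticeAdj p q ∧ s p ≠ s q}

/-- `D` is a finite union of king-connected components of the sign boundary. -/
structure IsBoundaryCluster (s : ℤ × ℤ → ZMod 2) (D : Finset (ℤ × ℤ)) : Prop where
  subset : ∀ p ∈ D, p ∈ signBoundary s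
  closed : ∀ p ∈ D, ∀ q ∈ signBoundary s, KingAdj p q → q ∈ D

/-- The sign change across the edge `{p, q}`, if this edge lies in `D`. -/
def signJump (D : Finset (ℤ × ℤ)) (s : ℤ × ℤ → ZMod 2) (p q : ℤ × ℤ) : ZMod 2 :=
  if p ∈ D ∧ q ∈ D then s p + s q else 0

/-- The sign function whose jumps are those of `s` inside `D`: the parity of the number of sign
changes inside `D` on the horizontal ray going left from `p`. -/
def interiorIndicator (D : Finset (ℤ × ℤ)) (s : ℤ × ℤ → ZMod 2) (p : ℤ × ℤ) : ZMod 2 :=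
  ∑ q ∈ D with q.2 = p.2 ∧ q.1 < p.1, signJump D s q (q.1 + 1, q.2)

variable {s : ℤ × ℤ → ZMod 2} {D : Finset (ℤ × ℤ)}

theorem signJump_comm (D : Finset (ℤ × ℤ)) (s : ℤ × ℤ → ZMod 2) (p q : ℤ × ℤ) :
    signJump D s p q = signJump D s q p := by
  simp only [signJump, and_comm, add_comm]

theorem signJump_of_eq {p q : ℤ × ℤ} (h : s p = s q) : signJump D s p q = 0 := by
  rw [signJump, CharTwo.add_eq_zero.2 h, ite_self]

theorem signJump_of_notMem {p q : ℤ × ℤ} (h : p ∉ D) : signJump D s p q = 0 :=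
  if_neg fun hpq => h hpq.1

theorem interiorIndicator_congr {s' : ℤ × ℤ → ZMod 2} (h : ∀ p ∈ D, s p = s' p) :
    interiorIndicator D s = interiorIndicator D s' := by
  funext p
  refine Finset.sum_congr rfl fun q _ => ?_
  unfold signJump
  split_ifs with hq
  · rw [h _ hq.1, h _ hq.2]
  · rfl

theorem LatticeAdj.mem_signBoundary {p q : ℤ × ℤ} (hpq : LatticeAdj p q) (h : s p ≠ s q) :
    p ∈ signBoundary s ∧ q ∈ signBoundary s :=
  ⟨⟨q, hpq, h⟩, ⟨p, hpq.symm, h.symm⟩⟩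

theorem IsBoundaryCluster.signJump_eq (hD : IsBoundaryCluster s D) {p q r : ℤ × ℤ}
    (hpq : LatticeAdj p q) (hr : r ∈ D) (hrp : KingAdj r p) (hrq : KingAdj r q) :
    signJump D s p q = s p + s q := by
  by_cases h : s p = s q
  · rw [signJump_of_eq h, CharTwo.add_eq_zero.2 h]
  · obtain ⟨hp, hq⟩ := hpq.mem_signBoundary h
    exact if_pos ⟨hD.closed r hr _ hp hrp, hD.closed r hr _ hq hrq⟩

theorem IsBoundaryCluster.plaquette (hD : IsBoundaryCluster s D) (i j : ℤ) :
    signJump D s (i, j) (i + 1, j) + signJump D s (i + 1, j) (i + 1, j + 1)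
      = signJump D s (i, j) (i, j + 1) + signJump D s (i, j + 1) (i + 1, j + 1) := by
  by_cases h : ∃ r ∈ D, (i ≤ r.1 ∧ r.1 ≤ i + 1) ∧ (j ≤ r.2 ∧ r.2 ≤ j + 1)
  · -- every corner of the plaquette is king-adjacent to `r`, so all four jumps are those of `s`
    obtain ⟨r, hr, _⟩ := h
    rw [hD.signJump_eq (by simp [LatticeAdj]) hr, hD.signJump_eq (by simp [LatticeAdj]) hr,
      hD.signJump_eq (by simp [LatticeAdj]) hr, hD.signJump_eq (by simp [LatticeAdj]) hr]
    · linear_combination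
        (s (i + 1, j) - s (i, j + 1)) * (CharTwo.two_eq_zero : (2 : ZMod 2) = 0)
    all_goals
      unfold KingAdj
      lia
  · have outside (q : ℤ × ℤ) (h₁ : i ≤ q.1 ∧ q.1 ≤ i + 1) (h₂ : j ≤ q.2 ∧ q.2 ≤ j + 1) : q ∉ D :=
      fun hq => h ⟨q, hq, h₁, h₂⟩
    simp [signJump_of_notMem (outside (i, j) (by simp) (by simp)),
      signJump_of_notMem (outside (i + 1, j) (by simp) (by simp)),
      signJump_of_notMem (outside (i, j + 1) (by simp) (by simp))]

theorem interiorIndicator_fst_succ (D : Finset (ℤ × ℤ)) (s : ℤ × ℤ → ZMod 2) (i j : ℤ) :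
    interiorIndicator D s (i + 1, j)
      = interiorIndicator D s (i, j) + signJump D s (i, j) (i + 1, j) := by
  unfold interiorIndicator
  by_cases h : (i, j) ∈ D
  · have hins : {q ∈ D | q.2 = j ∧ q.1 < i + 1} = insert (i, j) {q ∈ D | q.2 = j ∧ q.1 < i} := by
      ext ⟨a, b⟩
      simp only [Finset.mem_filter, Finset.mem_insert, Prod.mk.injEq]
      grind
    rw [hins, Finset.sum_insert (by simp), add_comm]
  · rw [signJump_of_notMem h, add_zero]
    congr 1
    ext ⟨a, b⟩
    simp only [Finset.mem_filter]
    grind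

theorem eq_of_eventually_atBot_of_succ {α : Type*} {f g : ℤ → α}
    (h₀ : ∀ᶠ i in atBot, f i = g i) (h₁ : ∀ i, f i = g i → f (i + 1) = g (i + 1)) (i : ℤ) :
    f i = g i := by
  obtain ⟨k, hki, hk⟩ := ((eventually_le_atBot i).and h₀).exists
  exact Int.leInduction hk (fun n _ => h₁ n) i hki

theorem eventually_notMem_and_interiorIndicator_eq_zero (D : Finset (ℤ × ℤ))
    (s : ℤ × ℤ → ZMod 2) :
    ∀ᶠ i in atBot, ∀ j, (i, j) ∉ D ∧ interiorIndicator D s (i, j) = 0 := by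
  filter_upwards [(Filter.eventually_all_finset D).2 fun q _ => eventually_lt_atBot q.1]
    with i hi j
  refine ⟨fun h => (hi _ h).false, Finset.sum_eq_zero fun q hq => ?_⟩
  rw [Finset.mem_filter] at hq
  exact absurd hq.2.2 (hi q hq.1).not_gt

theorem IsBoundaryCluster.interiorIndicator_snd_succ (hD : IsBoundaryCluster s D) (i j : ℤ) :
    interiorIndicator D s (i, j + 1)
      = interiorIndicator D s (i, j) + signJump D s (i, j) (i, j + 1) := by
  refine eq_of_eventually_atBot_of_succ (f := fun i => interiorIndicator D s (i, j + 1))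
    (g := fun i => interiorIndicator D s (i, j) + signJump D s (i, j) (i, j + 1)) ?_ ?_ i
  · filter_upwards [eventually_notMem_and_interiorIndicator_eq_zero D s] with i hi
    rw [(hi _).2, (hi _).2, signJump_of_notMem (hi j).1, add_zero]
  · intro i ih
    rw [interiorIndicator_fst_succ, interiorIndicator_fst_succ, ih, add_assoc, add_assoc,
      hD.plaquette]

theorem IsBoundaryCluster.interiorIndicator_of_latticeAdj (hD : IsBoundaryCluster s D)
    {p q : ℤ × ℤ} (h : LatticeAdj p q) :
    interiorIndicator D s q = interiorIndicator D s p + signJump D s p q := by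
  obtain ⟨i, j⟩ := p
  obtain ⟨k, l⟩ := q
  simp only [LatticeAdj] at h
  rcases h with ⟨rfl, rfl | rfl⟩ | ⟨rfl, rfl | rfl⟩
  · exact interiorIndicator_fst_succ D s i j
  · rw [interiorIndicator_fst_succ, signJump_comm, add_assoc, CharTwo.add_self_eq_zero, add_zero]
  · exact hD.interiorIndicator_snd_succ i j
  · rw [hD.interiorIndicator_snd_succ, signJump_comm, add_assoc, CharTwo.add_self_eq_zero,
      add_zero]

theorem exists_mem_of_interiorIndicator_ne_zero {t : ℤ × ℤ} (hne : interiorIndicator D s t ≠ 0)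
    (hright : ∃ r ≥ t.1, interiorIndicator D s (r, t.2) = 0) :
    ∃ r ≥ t.1, (r, t.2) ∈ D := by
  obtain ⟨r, hr, hr0⟩ := hright
  by_contra! h
  refine hne (Eq.trans ?_ hr0)
  unfold interiorIndicator
  congr 1
  ext ⟨a, b⟩
  simp only [Finset.mem_filter]
  grind

/-- The inner box `[0, m + 1]²`, outside of which all signs are positive. -/
noncomputable def innerBox (m : ℕ) : Finset (ℤ × ℤ) :=
  Finset.Icc 0 ((m : ℤ) + 1) ×ˢ Finset.Icc 0 ((m : ℤ) + 1)

/-- The outer box `[-1, m + 2]²`, outside of which all letters are `1`. -/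
noncomputable def outerBox (m : ℕ) : Finset (ℤ × ℤ) :=
  Finset.Icc (-1) ((m : ℤ) + 2) ×ˢ Finset.Icc (-1) ((m : ℤ) + 2)

variable {m : ℕ}

theorem mem_innerBox {p : ℤ × ℤ} :
    p ∈ innerBox m ↔ (0 ≤ p.1 ∧ p.1 ≤ m + 1) ∧ (0 ≤ p.2 ∧ p.2 ≤ m + 1) := by
  simp only [innerBox, Finset.mem_product, Finset.mem_Icc]

theorem mem_outerBox {p : ℤ × ℤ} :
    p ∈ outerBox m ↔ (-1 ≤ p.1 ∧ p.1 ≤ m + 2) ∧ (-1 ≤ p.2 ∧ p.2 ≤ m + 2) := by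
  simp only [outerBox, Finset.mem_product, Finset.mem_Icc]

theorem innerBox_subset_outerBox (m : ℕ) : innerBox m ⊆ outerBox m := by
  intro p hp
  rw [mem_innerBox] at hp
  rw [mem_outerBox]
  lia

theorem LatticeAdj.mem_outerBox {p q : ℤ × ℤ} (h : LatticeAdj p q) (hp : p ∈ innerBox m) :
    q ∈ outerBox m := by
  rw [mem_innerBox] at hp
  rw [_root_.mem_outerBox]
  unfold LatticeAdj at h
  lia

theorem mem_outerBox_of_mem_signBoundary (hs : ∀ p ∉ innerBox m, s p = 0) {p : ℤ × ℤ}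
    (hp : p ∈ signBoundary s) : p ∈ outerBox m := by
  obtain ⟨q, hpq, hne⟩ := hp
  by_contra h
  have hp0 : s p = 0 := hs p fun hp => h (innerBox_subset_outerBox m hp)
  have hq0 : s q = 0 := hs q fun hq => h (hpq.symm.mem_outerBox hq)
  exact hne (hp0.trans hq0.symm)

theorem interiorIndicator_eq_zero_of_row (hs : ∀ p ∉ innerBox m, s p = 0) {p : ℤ × ℤ}
    (hp : p.2 < 0 ∨ m + 1 < p.2 ∨ p.1 < 0) : interiorIndicator D s p = 0 := by
  refine Finset.sum_eq_zero fun q hq => signJump_of_eq ?_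
  rw [Finset.mem_filter] at hq
  rw [hs, hs] <;> rw [mem_innerBox] <;> lia

theorem IsBoundaryCluster.interiorIndicator_eq_zero (hs : ∀ p ∉ innerBox m, s p = 0)
    (hD : IsBoundaryCluster s D) {p : ℤ × ℤ} (hp : p ∉ innerBox m) :
    interiorIndicator D s p = 0 := by
  by_cases h : p.2 < 0 ∨ m + 1 < p.2 ∨ p.1 < 0
  · exact interiorIndicator_eq_zero_of_row hs h
  · -- the column of `p` misses the inner box, so the indicator is constant along it
    have hcol : ∀ j, (p.1, j) ∉ innerBox m := fun j => by
      rw [mem_innerBox] at hp ⊢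
      lia
    refine eq_of_eventually_atBot_of_succ (f := fun j => interiorIndicator D s (p.1, j))
      (g := fun _ => 0) ?_ ?_ p.2
    · filter_upwards [eventually_lt_atBot 0] with j hj
      exact interiorIndicator_eq_zero_of_row hs (Or.inl hj)
    · intro j ih
      rw [hD.interiorIndicator_snd_succ, ih, signJump_of_eq (by rw [hs _ (hcol _), hs _ (hcol _)]),
        add_zero]

/-- The relation of being king-adjacent inside the sign boundary. -/
def boundaryStep (s : ℤ × ℤ → ZMod 2) (p q : ℤ × ℤ) : Prop :=
  p ∈ signBoundary s ∧ q ∈ signBoundary s ∧ KingAdj p q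

open scoped Classical in
/-- The whole sign boundary, for a sign function vanishing outside `innerBox m`. -/
noncomputable def fullBoundary (m : ℕ) (s : ℤ × ℤ → ZMod 2) : Finset (ℤ × ℤ) :=
  (outerBox m).filter (· ∈ signBoundary s)

open scoped Classical in
/-- The king-connected component of `p` in the sign boundary. -/
noncomputable def boundaryComponent (m : ℕ) (s : ℤ × ℤ → ZMod 2) (p : ℤ × ℤ) : Finset (ℤ × ℤ) :=
  (outerBox m).filter fun q => Relation.ReflTransGen (boundaryStep s) p q

theorem mem_fullBoundary (hs : ∀ p ∉ innerBox m, s p = 0) {p : ℤ × ℤ} :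
    p ∈ fullBoundary m s ↔ p ∈ signBoundary s := by
  simp only [fullBoundary, Finset.mem_filter, and_iff_right_iff_imp]
  exact mem_outerBox_of_mem_signBoundary hs

theorem isBoundaryCluster_fullBoundary (hs : ∀ p ∉ innerBox m, s p = 0) :
    IsBoundaryCluster s (fullBoundary m s) where
  subset _ hp := (mem_fullBoundary hs).1 hp
  closed _ _ _ hq _ := (mem_fullBoundary hs).2 hq

theorem interiorIndicator_fullBoundary (hs : ∀ p ∉ innerBox m, s p = 0) (p : ℤ × ℤ) :
    interiorIndicator (fullBoundary m s) s p = s p := by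
  refine eq_of_eventually_atBot_of_succ
    (f := fun i => interiorIndicator (fullBoundary m s) s (i, p.2)) (g := fun i => s (i, p.2))
    ?_ ?_ p.1
  · filter_upwards [eventually_lt_atBot 0] with i hi
    rw [interiorIndicator_eq_zero_of_row hs (Or.inr (Or.inr hi)), hs]
    rw [mem_innerBox]
    lia
  · intro i ih
    rw [interiorIndicator_fst_succ, ih]
    by_cases h : s (i, p.2) = s (i + 1, p.2)
    · rw [signJump_of_eq h, add_zero, h]
    · have hmem := (latticeAdj_fst_succ (i, p.2)).mem_signBoundary h
      rw [signJump, if_pos ⟨(mem_fullBoundary hs).2 hmem.1, (mem_fullBoundary hs).2 hmem.2⟩,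
        ← add_assoc, CharTwo.add_self_eq_zero, zero_add]

theorem mem_signBoundary_of_reflTransGen {p q : ℤ × ℤ} (hp : p ∈ signBoundary s)
    (h : Relation.ReflTransGen (boundaryStep s) p q) : q ∈ signBoundary s := by
  rcases h.cases_tail with rfl | ⟨r, _, h⟩
  · exact hp
  · exact h.2.1

theorem mem_boundaryComponent (hs : ∀ p ∉ innerBox m, s p = 0) {p q : ℤ × ℤ}
    (hp : p ∈ signBoundary s) :
    q ∈ boundaryComponent m s p ↔ Relation.ReflTransGen (boundaryStep s) p q := by
  simp only [boundaryComponent, Finset.mem_filter, and_iff_right_iff_imp]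
  exact fun h => mem_outerBox_of_mem_signBoundary hs (mem_signBoundary_of_reflTransGen hp h)

theorem self_mem_boundaryComponent (hs : ∀ p ∉ innerBox m, s p = 0) {p : ℤ × ℤ}
    (hp : p ∈ signBoundary s) : p ∈ boundaryComponent m s p :=
  (mem_boundaryComponent hs hp).2 .refl

theorem isBoundaryCluster_boundaryComponent (hs : ∀ p ∉ innerBox m, s p = 0) {p : ℤ × ℤ}
    (hp : p ∈ signBoundary s) : IsBoundaryCluster s (boundaryComponent m s p) where
  subset q hq := mem_signBoundary_of_reflTransGen hp ((mem_boundaryComponent hs hp).1 hq)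
  closed q hq r hr hqr := by
    rw [mem_boundaryComponent hs hp] at hq ⊢
    exact hq.tail ⟨mem_signBoundary_of_reflTransGen hp hq, hr, hqr⟩

theorem boundaryComponent_eq_iff (hs : ∀ p ∉ innerBox m, s p = 0) {p q : ℤ × ℤ}
    (hp : p ∈ signBoundary s) (hq : q ∈ signBoundary s) :
    boundaryComponent m s q = boundaryComponent m s p ↔ q ∈ boundaryComponent m s p := by
  refine ⟨fun h => h ▸ self_mem_boundaryComponent hs hq, fun hpq => ?_⟩
  rw [mem_boundaryComponent hs hp] at hpq
  have : Std.Symm (boundaryStep s) := ⟨fun a b h => ⟨h.2.1, h.1, h.2.2.symm⟩⟩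
  have hqp : Relation.ReflTransGen (boundaryStep s) q p := symm_of _ hpq
  ext r
  rw [mem_boundaryComponent hs hp, mem_boundaryComponent hs hq]
  exact ⟨hpq.trans, hqp.trans⟩

theorem boundaryComponent_eq_of_closed (hs : ∀ p ∉ innerBox m, s p = 0) {p : ℤ × ℤ}
    (hp : p ∈ signBoundary s) {V : Finset (ℤ × ℤ)} (hV : V ⊆ boundaryComponent m s p) (hpV : p ∈ V)
    (hclosed : ∀ q ∈ V, ∀ r ∈ boundaryComponent m s p, r - q ∈ kingSteps → r ∈ V) :
    V = boundaryComponent m s p := by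
  refine hV.antisymm fun q hq => ?_
  induction (mem_boundaryComponent hs hp).1 hq with
  | refl => exact hpV
  | tail hpr hstep ih =>
    exact hclosed _ (ih ((mem_boundaryComponent hs hp).2 hpr)) _ hq
      (sub_mem_kingSteps.2 hstep.2.2)

theorem sum_fiber_boundaryComponent (hs : ∀ p ∉ innerBox m, s p = 0) {p : ℤ × ℤ}
    (hp : p ∈ signBoundary s) (t : ℤ × ℤ) :
    ∑ q ∈ {q ∈ fullBoundary m s | q.2 = t.2 ∧ q.1 < t.1} with
        boundaryComponent m s q = boundaryComponent m s p,
      signJump (fullBoundary m s) s q (q.1 + 1, q.2)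
      = interiorIndicator (boundaryComponent m s p) s t := by
  have hfull := isBoundaryCluster_fullBoundary hs
  have hcomp := isBoundaryCluster_boundaryComponent hs hp
  rw [Finset.filter_filter]
  refine Finset.sum_congr ?_ fun q hq => ?_
  · ext q
    simp only [Finset.mem_filter, mem_fullBoundary hs]
    constructor
    · rintro ⟨hq, hrow, heq⟩
      exact ⟨(boundaryComponent_eq_iff hs hp hq).1 heq, hrow⟩
    · rintro ⟨hq, hrow⟩
      exact ⟨hcomp.subset q hq, hrow, (boundaryComponent_eq_iff hs hp (hcomp.subset q hq)).2 hq⟩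
  · have hqC := (Finset.mem_filter.1 hq).1
    have hadj := latticeAdj_fst_succ q
    rw [hcomp.signJump_eq hadj hqC (.refl q) hadj.kingAdj,
      hfull.signJump_eq hadj ((mem_fullBoundary hs).2 (hcomp.subset q hqC)) (.refl q) hadj.kingAdj]

theorem exists_interiorIndicator_ne_zero (hs : ∀ p ∉ innerBox m, s p = 0) {t : ℤ × ℤ}
    (ht : s t ≠ 0) :
    ∃ l < t.1, (l, t.2) ∈ signBoundary s ∧
      interiorIndicator (boundaryComponent m s (l, t.2)) s t ≠ 0 := by
  rw [← interiorIndicator_fullBoundary hs, interiorIndicator, ← Finset.sum_fiberwise_of_maps_to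
    (g := boundaryComponent m s) (fun q hq => Finset.mem_image_of_mem _ hq)] at ht
  obtain ⟨C, hC, hne⟩ := Finset.exists_ne_zero_of_sum_ne_zero ht
  obtain ⟨⟨l, j⟩, hp, rfl⟩ := Finset.mem_image.1 hC
  rw [Finset.mem_filter, mem_fullBoundary hs] at hp
  obtain ⟨hp, rfl, hl⟩ := hp
  rw [sum_fiber_boundaryComponent hs hp] at hne
  exact ⟨l, hl, hp, hne⟩

theorem exists_mem_kingClusters (hs : ∀ p ∉ innerBox m, s p = 0) {t : ℤ × ℤ} (ht : s t ≠ 0) :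
    ∃ D : Finset (ℤ × ℤ), IsBoundaryCluster s D ∧ D.Nonempty ∧ D ⊆ outerBox m ∧
      D ∈ kingClusters t D.card := by
  obtain ⟨l, hl, hlb, hne⟩ := exists_interiorIndicator_ne_zero hs ht
  set D := boundaryComponent m s (l, t.2)
  have hD : IsBoundaryCluster s D := isBoundaryCluster_boundaryComponent hs hlb
  have hlD : (l, t.2) ∈ D := self_mem_boundaryComponent hs hlb
  refine ⟨D, hD, ⟨_, hlD⟩,
    fun q hq => mem_outerBox_of_mem_signBoundary hs (hD.subset q hq), ?_⟩
  obtain ⟨w, hw, hlen, hvis⟩ := exists_visit_eq (S := kingSteps)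
    (fun _ ha => neg_mem_kingSteps ha) hlD fun V => boundaryComponent_eq_of_closed hs hlb
  -- `D` surrounds `t`, so the walk crosses the row of `t` to the right of `t`
  obtain ⟨r, hrt, hrD⟩ : ∃ r ≥ t.1, (r, t.2) ∈ D := by
    refine exists_mem_of_interiorIndicator_ne_zero hne
      ⟨max t.1 (m + 2), le_max_left .., hD.interiorIndicator_eq_zero hs ?_⟩
    rw [mem_innerBox]
    lia
  have hdist : r ≤ l + w.length := fst_le_of_mem_visit hw (hvis ▸ hrD)
  have hpos : 0 < D.card := Finset.card_pos.2 ⟨_, hlD⟩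
  have hcl := visit_mem_kingClusters (t := t) (k := D.card) (j := (t.1 - l).toNat) (by lia) hw hlen
  rwa [Int.toNat_of_nonneg (by lia), sub_sub_cancel, hvis] at hcl

end Contours

section Peierls

/-- Configurations of the iceberg model on the square lattice that are positive outside
`[0, m + 1]²` and equal to `1` outside `[-1, m + 2]²`. -/
structure IsPlusConfig (M m : ℕ) (x : ℤ × ℤ → ℤ) : Prop where
  abs_le : ∀ p, |x p| ≤ M
  allowed : ∀ p q, LatticeAdj p q → icebergAllowed (x p) (x q)
  pos : ∀ p ∉ innerBox m, 0 < x p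
  eq_one : ∀ p ∉ outerBox m, x p = 1

/-- The indicator function of the negative sites. -/
def negSign (x : ℤ × ℤ → ℤ) (p : ℤ × ℤ) : ZMod 2 := if x p < 0 then 1 else 0

variable {M m : ℕ} {x : ℤ × ℤ → ℤ}

theorem negSign_eq_one_iff {p : ℤ × ℤ} : negSign x p = 1 ↔ x p < 0 := by
  unfold negSign
  split_ifs with h <;> simp [h]

theorem negSign_eq_iff {p q : ℤ × ℤ} : negSign x p = negSign x q ↔ (x p < 0 ↔ x q < 0) := by
  unfold negSign
  split_ifs with hp hq hq <;> simp [hp, hq]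

theorem icebergAllowed_iff {a b : ℤ} :
    icebergAllowed a b ↔ a ≠ 0 ∧ b ≠ 0 ∧ (¬ (a < 0 ↔ b < 0) → |a| = 1 ∧ |b| = 1) := by
  rw [icebergAllowed, abs_eq zero_le_one, abs_eq zero_le_one]
  by_cases ha : a < 0 <;> by_cases hb : b < 0 <;> simp only [ha, hb] <;> lia

theorem IsPlusConfig.ne_zero (hx : IsPlusConfig M m x) (p : ℤ × ℤ) : x p ≠ 0 :=
  (icebergAllowed_iff.1 (hx.allowed p _ (latticeAdj_fst_succ p))).1

theorem IsPlusConfig.negSign_eq_zero (hx : IsPlusConfig M m x) :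
    ∀ p ∉ innerBox m, negSign x p = 0 := fun p hp => by
  simp [negSign, (hx.pos p hp).le]

theorem IsPlusConfig.abs_eq_one (hx : IsPlusConfig M m x) {p : ℤ × ℤ}
    (hp : p ∈ signBoundary (negSign x)) : |x p| = 1 := by
  obtain ⟨q, hpq, hne⟩ := hp
  exact ((icebergAllowed_iff.1 (hx.allowed p q hpq)).2.2 (mt negSign_eq_iff.2 hne)).1

/-- The configuration obtained by changing the signs in the interior of the contours in `D`, and
putting letters of absolute values `u + 1` on the sites of `D`: it has no contour in `D` anymore. -/
def flipCluster (D : Finset (ℤ × ℤ)) (u : D → Fin M) (x : ℤ × ℤ → ℤ) (p : ℤ × ℤ) : ℤ :=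
  (if negSign x p + interiorIndicator D (negSign x) p = 1 then -1 else 1) *
    if h : p ∈ D then ((u ⟨p, h⟩ : ℕ) : ℤ) + 1 else |x p|

variable {D : Finset (ℤ × ℤ)}

theorem IsPlusConfig.flippedAbs_pos (hx : IsPlusConfig M m x) (u : D → Fin M) (p : ℤ × ℤ) :
    0 < if h : p ∈ D then ((u ⟨p, h⟩ : ℕ) : ℤ) + 1 else |x p| := by
  split_ifs with h
  · positivity
  · exact abs_pos.2 (hx.ne_zero p)

theorem IsPlusConfig.abs_flipCluster (hx : IsPlusConfig M m x) (u : D → Fin M) (p : ℤ × ℤ) :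
    |flipCluster D u x p| = if h : p ∈ D then ((u ⟨p, h⟩ : ℕ) : ℤ) + 1 else |x p| := by
  rw [_root_.flipCluster, abs_mul, abs_of_pos (hx.flippedAbs_pos u p)]
  split_ifs <;> simp

theorem IsPlusConfig.flipCluster_neg_iff (hx : IsPlusConfig M m x) (u : D → Fin M) (p : ℤ × ℤ) :
    flipCluster D u x p < 0 ↔ negSign x p + interiorIndicator D (negSign x) p = 1 := by
  have h := hx.flippedAbs_pos u p
  unfold _root_.flipCluster
  by_cases hsign : negSign x p + interiorIndicator D (negSign x) p = 1
  · rw [if_pos hsign, neg_one_mul, neg_lt_zero]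
    exact iff_of_true h hsign
  · rw [if_neg hsign, one_mul]
    exact iff_of_false h.not_gt hsign

theorem IsPlusConfig.flipCluster_ne_zero (hx : IsPlusConfig M m x) (u : D → Fin M) (p : ℤ × ℤ) :
    flipCluster D u x p ≠ 0 :=
  abs_pos.1 ((hx.flippedAbs_pos u p).trans_eq (hx.abs_flipCluster u p).symm)

theorem zmod_two_add_add_eq_one {a b i j g : ZMod 2} (hij : j = i + g)
    (hne : ¬ (a + i = 1 ↔ b + j = 1)) : a + b + g = 1 := by
  revert a b i j g
  decide

/-- A sign change of the new configuration is a sign change of the old one outside `D`, because the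
jumps of the interior indicator cancel those of `x` inside `D`. -/
theorem IsPlusConfig.notMem_of_flipCluster_sign_change (hx : IsPlusConfig M m x)
    (hD : IsBoundaryCluster (negSign x) D) (u : D → Fin M) {p q : ℤ × ℤ} (hpq : LatticeAdj p q)
    (h : ¬ (flipCluster D u x p < 0 ↔ flipCluster D u x q < 0)) :
    p ∉ D ∧ p ∈ signBoundary (negSign x) := by
  rw [hx.flipCluster_neg_iff, hx.flipCluster_neg_iff] at h
  have hjump := zmod_two_add_add_eq_one (hD.interiorIndicator_of_latticeAdj hpq) h
  have hp : p ∉ D := fun hp => by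
    rw [hD.signJump_eq hpq hp (.refl p) hpq.kingAdj, CharTwo.add_self_eq_zero] at hjump
    exact zero_ne_one hjump
  refine ⟨hp, (hpq.mem_signBoundary fun heq => ?_).1⟩
  rw [signJump_of_notMem hp, CharTwo.add_eq_zero.2 heq, zero_add] at hjump
  exact zero_ne_one hjump

theorem IsPlusConfig.flipCluster (hx : IsPlusConfig M m x)
    (hD : IsBoundaryCluster (negSign x) D) (u : D → Fin M) :
    IsPlusConfig M m (flipCluster D u x) where
  abs_le p := by
    rw [hx.abs_flipCluster]
    split_ifs with h
    · exact_mod_cast (u ⟨p, h⟩).isLt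
    · exact hx.abs_le p
  allowed p q hpq := by
    have abs_eq (r : ℤ × ℤ) (hr : r ∉ D ∧ r ∈ signBoundary (negSign x)) :
        |_root_.flipCluster D u x r| = 1 := by
      rw [hx.abs_flipCluster, dif_neg hr.1, hx.abs_eq_one hr.2]
    refine icebergAllowed_iff.2 ⟨hx.flipCluster_ne_zero u p, hx.flipCluster_ne_zero u q,
      fun h => ⟨abs_eq p ?_, abs_eq q ?_⟩⟩
    · exact hx.notMem_of_flipCluster_sign_change hD u hpq h
    · exact hx.notMem_of_flipCluster_sign_change hD u hpq.symm fun h' => h h'.symm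
  pos p hp := by
    refine lt_of_le_of_ne (not_lt.1 ?_) (hx.flipCluster_ne_zero u p).symm
    rw [hx.flipCluster_neg_iff, hx.negSign_eq_zero p hp,
      hD.interiorIndicator_eq_zero hx.negSign_eq_zero hp, add_zero]
    exact zero_ne_one
  eq_one p hp := by
    have hin : p ∉ innerBox m := fun h => hp (innerBox_subset_outerBox m h)
    have hpD : p ∉ D := fun h =>
      hp (mem_outerBox_of_mem_signBoundary hx.negSign_eq_zero (hD.subset p h))
    simp [_root_.flipCluster, hx.negSign_eq_zero p hin, hpD, hx.eq_one p hp,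
      hD.interiorIndicator_eq_zero hx.negSign_eq_zero hin]

theorem eq_of_abs_eq_of_neg_iff {a b : ℤ} (h : |a| = |b|) (hneg : a < 0 ↔ b < 0) : a = b := by
  grind

theorem flipCluster_injective {x₁ x₂ : ℤ × ℤ → ℤ} {u₁ u₂ : D → Fin M}
    (h₁ : IsPlusConfig M m x₁) (h₂ : IsPlusConfig M m x₂)
    (hD₁ : IsBoundaryCluster (negSign x₁) D) (hD₂ : IsBoundaryCluster (negSign x₂) D)
    (hsign : ∀ p ∈ D, negSign x₁ p = negSign x₂ p)
    (h : flipCluster D u₁ x₁ = flipCluster D u₂ x₂) : x₁ = x₂ ∧ u₁ = u₂ := by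
  have habs (p : ℤ × ℤ) : (if h : p ∈ D then ((u₁ ⟨p, h⟩ : ℕ) : ℤ) + 1 else |x₁ p|)
      = if h : p ∈ D then ((u₂ ⟨p, h⟩ : ℕ) : ℤ) + 1 else |x₂ p| := by
    rw [← h₁.abs_flipCluster, ← h₂.abs_flipCluster, h]
  constructor
  · funext p
    refine eq_of_abs_eq_of_neg_iff ?_ ?_
    · by_cases hp : p ∈ D
      · rw [h₁.abs_eq_one (hD₁.subset p hp), h₂.abs_eq_one (hD₂.subset p hp)]
      · simpa [hp] using habs p
    · have hneg := h₁.flipCluster_neg_iff u₁ p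
      rw [h, h₂.flipCluster_neg_iff u₂ p, interiorIndicator_congr hsign] at hneg
      rw [← negSign_eq_one_iff, ← negSign_eq_one_iff]
      generalize interiorIndicator D (negSign x₂) p = c at hneg
      generalize negSign x₁ p = a at hneg
      generalize negSign x₂ p = b at hneg
      revert a b c
      decide
  · funext ⟨p, hp⟩
    simpa [hp, Fin.ext_iff] using habs p

theorem finite_isPlusConfig (M m : ℕ) : {x | IsPlusConfig M m x}.Finite := by
  refine Set.Finite.of_finite_image (f := (outerBox m).restrict (π := fun _ => ℤ))
    (Set.Finite.subset (Set.Finite.pi' fun _ : outerBox m => Set.finite_Icc (-(M : ℤ)) M) ?_) ?_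
  · rintro _ ⟨x, hx, rfl⟩ p
    exact Set.mem_Icc.2 (_root_.abs_le.1 (hx.abs_le p))
  · intro x hx y hy h
    funext p
    by_cases hp : p ∈ outerBox m
    · exact congrFun h ⟨p, hp⟩
    · rw [hx.eq_one p hp, hy.eq_one p hp]

/-- The finite set of configurations with plus boundary condition. -/
noncomputable def plusConfigs (M m : ℕ) : Finset (ℤ × ℤ → ℤ) := (finite_isPlusConfig M m).toFinset

theorem mem_plusConfigs : x ∈ plusConfigs M m ↔ IsPlusConfig M m x := by simp [plusConfigs]

open scoped Classical in
/-- The configurations with plus boundary condition for which `D` is a cluster of the sign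
boundary. -/
noncomputable def plusConfigsWithCluster (M m : ℕ) (D : Finset (ℤ × ℤ)) : Finset (ℤ × ℤ → ℤ) :=
  (plusConfigs M m).filter fun x => IsBoundaryCluster (negSign x) D

theorem mem_plusConfigsWithCluster :
    x ∈ plusConfigsWithCluster M m D ↔ IsPlusConfig M m x ∧ IsBoundaryCluster (negSign x) D := by
  simp [plusConfigsWithCluster, mem_plusConfigs]

theorem card_filter_signPattern_mul_le (M m : ℕ) (D : Finset (ℤ × ℤ)) (τ : D → ZMod 2) :
    ((plusConfigsWithCluster M m D).filter fun x => (fun p : D => negSign x p) = τ).card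
      * M ^ D.card ≤ (plusConfigs M m).card := by
  set E := (plusConfigsWithCluster M m D).filter fun x => (fun p : D => negSign x p) = τ with hE
  have mem_E {x} (hx : x ∈ E) : IsPlusConfig M m x ∧ IsBoundaryCluster (negSign x) D ∧
      ∀ p : D, negSign x p = τ p := by
    rw [hE, Finset.mem_filter, mem_plusConfigsWithCluster] at hx
    exact ⟨hx.1.1, hx.1.2, congrFun hx.2⟩
  calc E.card * M ^ D.card = (E ×ˢ (Finset.univ : Finset (D → Fin M))).card := by
        simp [Finset.card_product]
    _ ≤ (plusConfigs M m).card := by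
        refine Finset.card_le_card_of_injOn (fun xu => flipCluster D xu.2 xu.1) ?_ ?_
        · rintro ⟨x, u⟩ hxu
          obtain ⟨hx, hD, -⟩ := mem_E (Finset.mem_product.1 hxu).1
          exact mem_plusConfigs.2 (hx.flipCluster hD u)
        · rintro ⟨x₁, u₁⟩ hxu₁ ⟨x₂, u₂⟩ hxu₂ h
          obtain ⟨hx₁, hD₁, hτ₁⟩ := mem_E (Finset.mem_product.1 hxu₁).1
          obtain ⟨hx₂, hD₂, hτ₂⟩ := mem_E (Finset.mem_product.1 hxu₂).1
          obtain ⟨rfl, rfl⟩ := flipCluster_injective hx₁ hx₂ hD₁ hD₂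
            (fun p hp => (hτ₁ ⟨p, hp⟩).trans (hτ₂ ⟨p, hp⟩).symm) h
          rfl

theorem card_plusConfigsWithCluster_mul_le (M m : ℕ) (D : Finset (ℤ × ℤ)) :
    (plusConfigsWithCluster M m D).card * M ^ D.card ≤ 2 ^ D.card * (plusConfigs M m).card := by
  calc (plusConfigsWithCluster M m D).card * M ^ D.card
      = ∑ τ : D → ZMod 2, ((plusConfigsWithCluster M m D).filter
          fun x => (fun p : D => negSign x p) = τ).card * M ^ D.card := by
        rw [← Finset.sum_mul]
        exact congrArg (· * _) (Finset.card_eq_sum_card_fiberwise fun _ _ => Finset.mem_univ _)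
    _ ≤ ∑ _τ : D → ZMod 2, (plusConfigs M m).card :=
        Finset.sum_le_sum fun τ _ => card_filter_signPattern_mul_le M m D τ
    _ = 2 ^ D.card * (plusConfigs M m).card := by simp [ZMod.card]

theorem sum_card_plusConfigsWithCluster_le (hM : 0 < M) (m : ℕ) (t : ℤ × ℤ) {k : ℕ} (hk : 1 ≤ k) :
    ∑ D ∈ kingClusters t k with D.card = k, ((plusConfigsWithCluster M m D).card : ℝ)
      ≤ (324 / M) ^ k * (plusConfigs M m).card := by
  calc ∑ D ∈ kingClusters t k with D.card = k, ((plusConfigsWithCluster M m D).card : ℝ)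
      ≤ ∑ D ∈ kingClusters t k with D.card = k, (2 / M) ^ k * ((plusConfigs M m).card : ℝ) := by
        refine Finset.sum_le_sum fun D hD => ?_
        rw [div_pow, div_mul_eq_mul_div, le_div_iff₀ (by positivity), ← (Finset.mem_filter.1 hD).2]
        exact_mod_cast card_plusConfigsWithCluster_mul_le M m D
    _ = ((kingClusters t k).filter fun D => D.card = k).card
          * ((2 / M) ^ k * ((plusConfigs M m).card : ℝ)) := by
        rw [Finset.sum_const, nsmul_eq_mul]
    _ ≤ 162 ^ k * ((2 / M) ^ k * (plusConfigs M m).card) := by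
        gcongr
        exact_mod_cast (Finset.card_filter_le _ _).trans (card_kingClusters_le t hk)
    _ = (324 / M) ^ k * (plusConfigs M m).card := by
        rw [← mul_assoc, ← mul_pow]
        ring

open scoped Classical in
theorem card_filter_neg_le_sum (M m : ℕ) (t : ℤ × ℤ) :
    ((plusConfigs M m).filter fun x => x t < 0).card ≤ ∑ k ∈ Finset.Icc 1 (outerBox m).card,
      ∑ D ∈ kingClusters t k with D.card = k, (plusConfigsWithCluster M m D).card := by
  have hsub : ((plusConfigs M m).filter fun x => x t < 0) ⊆
      (Finset.Icc 1 (outerBox m).card).biUnion fun k =>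
        ((kingClusters t k).filter fun D => D.card = k).biUnion (plusConfigsWithCluster M m) := by
    intro x hx
    rw [Finset.mem_filter, mem_plusConfigs] at hx
    obtain ⟨D, hD, hne, hsub, hmem⟩ := exists_mem_kingClusters hx.1.negSign_eq_zero
      (t := t) (negSign_eq_one_iff.2 hx.2 ▸ one_ne_zero)
    simp only [Finset.mem_biUnion, Finset.mem_Icc, Finset.mem_filter, mem_plusConfigsWithCluster]
    exact ⟨D.card, ⟨hne.card_pos, Finset.card_le_card hsub⟩, D, ⟨hmem, rfl⟩, hx.1, hD⟩
  exact (Finset.card_le_card hsub).trans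
    (Finset.card_biUnion_le.trans (Finset.sum_le_sum fun _ _ => Finset.card_biUnion_le))

open scoped Classical in
theorem card_filter_neg_le (hM : 324 < M) (m : ℕ) (t : ℤ × ℤ) :
    (((plusConfigs M m).filter fun x => x t < 0).card : ℝ)
      ≤ 324 / (M - 324) * (plusConfigs M m).card := by
  have hM' : (324 : ℝ) < M := by exact_mod_cast hM
  calc (((plusConfigs M m).filter fun x => x t < 0).card : ℝ)
      ≤ ∑ k ∈ Finset.Icc 1 (outerBox m).card, ∑ D ∈ kingClusters t k with D.card = k,
          ((plusConfigsWithCluster M m D).card : ℝ) := by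
        exact_mod_cast card_filter_neg_le_sum M m t
    _ ≤ ∑ k ∈ Finset.Icc 1 (outerBox m).card, (324 / M) ^ k * ((plusConfigs M m).card : ℝ) :=
        Finset.sum_le_sum fun k hk =>
          sum_card_plusConfigsWithCluster_le (by lia) m t (Finset.mem_Icc.1 hk).1
    _ ≤ (324 / M) ^ 1 / (1 - 324 / M) * (plusConfigs M m).card := by
        rw [← Finset.sum_mul, ← Finset.Ico_add_one_right_eq_Icc]
        gcongr
        exact geom_sum_Ico_le_of_lt_one (by positivity) ((div_lt_one (by linarith)).2 hM')
    _ = 324 / (M - 324) * (plusConfigs M m).card := by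
        have : (M : ℝ) - 324 ≠ 0 := by linarith
        field_simp

end Peierls

section Ring

variable {M m : ℕ} {x : ℤ × ℤ → ℤ} {p q : ℤ × ℤ}

/-- The square `[1, m]²`, on which the configurations with plus boundary condition are free. -/
noncomputable def coreBox (m : ℕ) : Finset (ℤ × ℤ) := Finset.Icc 1 (m : ℤ) ×ˢ Finset.Icc 1 (m : ℤ)

theorem mem_coreBox : p ∈ coreBox m ↔ (1 ≤ p.1 ∧ p.1 ≤ m) ∧ (1 ≤ p.2 ∧ p.2 ≤ m) := by
  simp only [coreBox, Finset.mem_product, Finset.mem_Icc]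

theorem coreBox_subset_innerBox (m : ℕ) : coreBox m ⊆ innerBox m := by
  intro p hp
  rw [mem_coreBox] at hp
  rw [mem_innerBox]
  lia

/-- The coordinatewise projection of the plane to `[1, m]²`. -/
def coreProj (m : ℕ) (p : ℤ × ℤ) : ℤ × ℤ := (max 1 (min p.1 m), max 1 (min p.2 m))

/-- The configuration `x` on `[1, m]²`, surrounded by a layer of letters `±1` copying the signs
of `x`, and by letters `1` outside. -/
noncomputable def surround (m : ℕ) (x : ℤ × ℤ → ℤ) (p : ℤ × ℤ) : ℤ :=
  if p ∈ coreBox m then x p else if p ∈ innerBox m then (x (coreProj m p)).sign else 1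

theorem surround_of_mem_coreBox (hp : p ∈ coreBox m) : surround m x p = x p := if_pos hp

theorem surround_of_latticeAdj (hp : p ∈ coreBox m) (hq : q ∉ coreBox m) (hpq : LatticeAdj p q) :
    surround m x q = (x p).sign := by
  rw [mem_coreBox] at hp
  have hin : q ∈ innerBox m := by
    rw [mem_innerBox]
    unfold LatticeAdj at hpq
    lia
  have hproj : coreProj m q = p := by
    rw [mem_coreBox] at hq
    unfold LatticeAdj at hpq
    ext <;> simp only [coreProj] <;> lia
  rw [surround, if_neg hq, if_pos hin, hproj]

theorem abs_surround_of_notMem_coreBox (hx : ∀ p, x p ≠ 0) (hp : p ∉ coreBox m) :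
    |surround m x p| = 1 := by
  rw [surround, if_neg hp]
  split_ifs
  · exact Int.abs_sign_of_ne_zero (hx _)
  · exact abs_one

theorem surround_ne_zero (hx : ∀ p, x p ≠ 0) (p : ℤ × ℤ) : surround m x p ≠ 0 := by
  by_cases hp : p ∈ coreBox m
  · rw [surround_of_mem_coreBox hp]
    exact hx p
  · rw [← abs_pos, abs_surround_of_notMem_coreBox hx hp]
    exact one_pos

theorem icebergAllowed_surround (hx : ∀ p q, LatticeAdj p q → icebergAllowed (x p) (x q))
    (hpq : LatticeAdj p q) : icebergAllowed (surround m x p) (surround m x q) := by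
  have hx₀ (p : ℤ × ℤ) : x p ≠ 0 := (icebergAllowed_iff.1 (hx p _ (latticeAdj_fst_succ p))).1
  refine icebergAllowed_iff.2 ⟨surround_ne_zero hx₀ p, surround_ne_zero hx₀ q, fun h => ?_⟩
  by_cases hp : p ∈ coreBox m <;> by_cases hq : q ∈ coreBox m
  · rw [surround_of_mem_coreBox hp, surround_of_mem_coreBox hq] at h ⊢
    exact (icebergAllowed_iff.1 (hx p q hpq)).2.2 h
  · rw [surround_of_mem_coreBox hp, surround_of_latticeAdj hp hq hpq, Int.sign_neg_iff] at h
    exact absurd Iff.rfl h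
  · rw [surround_of_mem_coreBox hq, surround_of_latticeAdj hq hp hpq.symm, Int.sign_neg_iff] at h
    exact absurd Iff.rfl h
  · exact ⟨abs_surround_of_notMem_coreBox hx₀ hp, abs_surround_of_notMem_coreBox hx₀ hq⟩

theorem isPlusConfig_surround (habs : ∀ p, |x p| ≤ M)
    (hx : ∀ p q, LatticeAdj p q → icebergAllowed (x p) (x q)) :
    IsPlusConfig M m (surround m x) where
  abs_le p := by
    have hx₀ (p : ℤ × ℤ) : x p ≠ 0 := (icebergAllowed_iff.1 (hx p _ (latticeAdj_fst_succ p))).1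
    by_cases hp : p ∈ coreBox m
    · rw [surround_of_mem_coreBox hp]
      exact habs p
    · rw [abs_surround_of_notMem_coreBox hx₀ hp]
      exact (Int.one_le_abs (hx₀ p)).trans (habs p)
  allowed _ _ hpq := icebergAllowed_surround hx hpq
  pos p hp := by
    rw [surround, if_neg fun h => hp (coreBox_subset_innerBox m h), if_neg hp]
    exact one_pos
  eq_one p hp := by
    have hin : p ∉ innerBox m := fun h => hp (innerBox_subset_outerBox m h)
    rw [surround, if_neg fun h => hin (coreBox_subset_innerBox m h), if_neg hin]

theorem mem_icebergAlphabet {a : ℤ} :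
    a ∈ (Finset.Icc (-(M : ℤ)) (M : ℤ)).erase 0 ↔ a ≠ 0 ∧ |a| ≤ M := by
  rw [Finset.mem_erase, Finset.mem_Icc, abs_le]

theorem mem_iceberg {x : (Fin 2 → ℤ) → IcebergAlphabet M} :
    x ∈ (iceberg M).carrier ↔
      ∀ (i : Fin 2) (t : Fin 2 → ℤ), icebergAllowed (x t).1 (x (t + Pi.single i 1)).1 := by
  simp [iceberg, nearestNeighborSFT]

theorem icebergAllowed.symm {a b : ℤ} (h : icebergAllowed a b) : icebergAllowed b a := by
  unfold icebergAllowed at *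
  lia

/-- The configuration on `ℤ × ℤ` with the letters of a configuration indexed by `Fin 2 → ℤ`. -/
def planarConfig (x : (Fin 2 → ℤ) → IcebergAlphabet M) (p : ℤ × ℤ) : ℤ :=
  (x ((finTwoArrowEquiv ℤ).symm p)).1

theorem LatticeAdj.exists_eq_add_single (h : LatticeAdj p q) : ∃ i : Fin 2,
    (finTwoArrowEquiv ℤ).symm q = (finTwoArrowEquiv ℤ).symm p + Pi.single i 1 ∨
      (finTwoArrowEquiv ℤ).symm p = (finTwoArrowEquiv ℤ).symm q + Pi.single i 1 := by
  rcases h with ⟨h₂, h₁⟩ | ⟨h₁, h₂⟩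
  · exact ⟨0, h₁.imp (fun h => by ext i; fin_cases i <;> simp [h, h₂])
      fun h => by ext i; fin_cases i <;> simp [h, h₂]⟩
  · exact ⟨1, h₂.imp (fun h => by ext i; fin_cases i <;> simp [h, h₁])
      fun h => by ext i; fin_cases i <;> simp [h, h₁]⟩

theorem icebergAllowed_planarConfig {x : (Fin 2 → ℤ) → IcebergAlphabet M}
    (hx : x ∈ (iceberg M).carrier) (p q : ℤ × ℤ) (hpq : LatticeAdj p q) :
    icebergAllowed (planarConfig x p) (planarConfig x q) := by
  obtain ⟨i, h | h⟩ := hpq.exists_eq_add_single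
  · rw [planarConfig, planarConfig, h]
    exact mem_iceberg.1 hx i _
  · rw [planarConfig, planarConfig, h]
    exact (mem_iceberg.1 hx i _).symm

theorem restrict_box_eq_of_surround_planarConfig_eq {x y : (Fin 2 → ℤ) → IcebergAlphabet M}
    (h : surround m (planarConfig x) = surround m (planarConfig y)) :
    (box fun _ => m).restrict x = (box fun _ => m).restrict y := by
  funext ⟨t, ht⟩
  have hcore : finTwoArrowEquiv ℤ t ∈ coreBox m :=
    mem_coreBox.2 ⟨mem_box.1 ht 0, mem_box.1 ht 1⟩
  have ht' := congrFun h (finTwoArrowEquiv ℤ t)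
  rw [surround_of_mem_coreBox hcore, surround_of_mem_coreBox hcore, planarConfig, planarConfig,
    Equiv.symm_apply_apply] at ht'
  exact Subtype.ext ht'

theorem ncard_languageOfShape_le_card_plusConfigs (M m : ℕ) :
    (languageOfShape (iceberg M) (box fun _ => m)).ncard ≤ (plusConfigs M m).card := by
  obtain ⟨S, hS, hbij⟩ := (Set.surjOn_image (box fun _ : Fin 2 => m).restrict
    (iceberg M).carrier).exists_bijOn_subset
  rw [languageOfShape, ← hbij.image_eq, hbij.injOn.ncard_image, ← Set.ncard_coe_finset]
  refine Set.ncard_le_ncard_of_injOn (fun x => surround m (planarConfig x)) (fun x hx => ?_)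
    fun x hx y hy h => hbij.injOn hx hy (restrict_box_eq_of_surround_planarConfig_eq h)
  exact mem_plusConfigs.2 (isPlusConfig_surround (fun p => (mem_icebergAlphabet.1 (x _).2).2)
    (icebergAllowed_planarConfig (hS hx)))

end Ring

section TorusConfigs

variable {M m : ℕ} {x : ℤ × ℤ → ℤ}

/-- The planar site represented by a point of the torus of side `m + 5`: the torus is cut open
along a line that misses `outerBox m`. -/
def torusSite (t : Fin 2 → ZMod (m + 5)) : ℤ × ℤ := (((t 0).val : ℤ) - 2, ((t 1).val : ℤ) - 2)

theorem zmod_val_add_one_eq (a : ZMod (m + 5)) :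
    (a + 1).val = a.val + 1 ∨ a.val = m + 4 ∧ (a + 1).val = 0 := by
  have hlt := ZMod.val_lt a
  rw [ZMod.val_add, ZMod.val_one'' (by lia)]
  rcases Nat.lt_or_ge (a.val + 1) (m + 5) with h | h
  · exact .inl (Nat.mod_eq_of_lt h)
  · have ha : a.val = m + 4 := by lia
    exact .inr ⟨ha, ha ▸ Nat.mod_self _⟩

theorem latticeAdj_torusSite_or_notMem_innerBox (i : Fin 2) (t : Fin 2 → ZMod (m + 5)) :
    LatticeAdj (torusSite t) (torusSite (t + Pi.single i 1)) ∨
      torusSite t ∉ innerBox m ∧ torusSite (t + Pi.single i 1) ∉ innerBox m := by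
  simp only [LatticeAdj, mem_innerBox, torusSite, Pi.add_apply]
  match i with
  | 0 =>
    have := zmod_val_add_one_eq (t 0)
    simp only [Pi.single_eq_same, Pi.single_eq_of_ne one_ne_zero, add_zero]
    lia
  | 1 =>
    have := zmod_val_add_one_eq (t 1)
    simp only [Pi.single_eq_same, Pi.single_eq_of_ne zero_ne_one, add_zero]
    lia

theorem IsPlusConfig.icebergAllowed_torusSite (hx : IsPlusConfig M m x) (i : Fin 2)
    (t : Fin 2 → ZMod (m + 5)) :
    icebergAllowed (x (torusSite t)) (x (torusSite (t + Pi.single i 1))) := by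
  rcases latticeAdj_torusSite_or_notMem_innerBox i t with h | ⟨h, h'⟩
  · exact hx.allowed _ _ h
  · exact .inl ⟨hx.pos _ h, hx.pos _ h'⟩

theorem exists_torusSite_eq {p : ℤ × ℤ} (hp : p ∈ outerBox m) :
    ∃ t : Fin 2 → ZMod (m + 5), torusSite t = p := by
  rw [mem_outerBox] at hp
  refine ⟨![((p.1 + 2).toNat : ZMod (m + 5)), ((p.2 + 2).toNat : ZMod (m + 5))], ?_⟩
  simp only [torusSite, Matrix.cons_val_zero, Matrix.cons_val_one]
  rw [ZMod.val_natCast_of_lt (by lia), ZMod.val_natCast_of_lt (by lia)]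
  ext <;> dsimp only <;> lia

theorem icebergAllowed.unit_mul {a b : ℤ} (h : icebergAllowed a b) (ε : ℤˣ) :
    icebergAllowed (ε * a) (ε * b) := by
  unfold icebergAllowed at h ⊢
  rcases Int.units_eq_one_or ε with rfl | rfl <;> simp only [Units.val_neg, Units.val_one] <;> lia

/-- The torus configuration with the letters of `ε x`. -/
def torusConfig (ε : ℤˣ) (hx : IsPlusConfig M m x) (t : Fin 2 → ZMod (m + 5)) :
    IcebergAlphabet M :=
  ⟨ε * x (torusSite t), mem_icebergAlphabet.2 ⟨mul_ne_zero ε.ne_zero (hx.ne_zero _), by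
    rw [abs_mul, Int.isUnit_iff_abs_eq.1 ε.isUnit, one_mul]
    exact hx.abs_le _⟩⟩

theorem torusConfig_inj {ε : ℤˣ} {y : ℤ × ℤ → ℤ} (hx : IsPlusConfig M m x)
    (hy : IsPlusConfig M m y) (h : torusConfig ε hx = torusConfig ε hy) : x = y := by
  funext p
  by_cases hp : p ∈ outerBox m
  · obtain ⟨t, rfl⟩ := exists_torusSite_eq hp
    exact mul_left_cancel₀ ε.ne_zero (congrArg Subtype.val (congrFun h t))
  · rw [hx.eq_one p hp, hy.eq_one p hp]

/-- The letters of the sign `ε`. -/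
def lettersOfSign (M : ℕ) (ε : ℤˣ) : Set (IcebergAlphabet M) := {a | 0 < (ε : ℤ) * a.1}

theorem torusConfig_mem_lettersOfSign {ε : ℤˣ} (hx : IsPlusConfig M m x)
    {t : Fin 2 → ZMod (m + 5)} :
    torusConfig ε hx t ∈ lettersOfSign M ε ↔ ¬ x (torusSite t) < 0 := by
  change 0 < (ε : ℤ) * ((ε : ℤ) * x (torusSite t)) ↔ _
  rw [← mul_assoc, ← Units.val_mul, Int.units_mul_self, Units.val_one, one_mul, not_lt]
  exact ⟨le_of_lt, fun h => h.lt_of_ne (hx.ne_zero _).symm⟩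

open scoped Classical in
/-- The legal configurations on the torus of side `m + 5` at least three quarters of whose letters
have the sign `ε`. -/
noncomputable def biasedTorusConfigs (M m : ℕ) (ε : ℤˣ) :
    Finset ((Fin 2 → ZMod (m + 5)) → IcebergAlphabet M) :=
  Finset.univ.filter fun y =>
    (∀ i t, icebergAllowed (y t).1 (y (t + Pi.single i 1)).1) ∧
      3 / 4 * ((m + 5 : ℕ) : ℝ) ^ 2 ≤ (Finset.univ.filter fun t => y t ∈ lettersOfSign M ε).card

open scoped Classical in
theorem mem_biasedTorusConfigs {ε : ℤˣ} {y : (Fin 2 → ZMod (m + 5)) → IcebergAlphabet M} :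
    y ∈ biasedTorusConfigs M m ε ↔
      (∀ i t, icebergAllowed (y t).1 (y (t + Pi.single i 1)).1) ∧
      3 / 4 * ((m + 5 : ℕ) : ℝ) ^ 2
        ≤ (Finset.univ.filter fun t => y t ∈ lettersOfSign M ε).card := by
  simp only [biasedTorusConfigs, Finset.mem_filter, Finset.mem_univ, true_and]

theorem card_torus (m : ℕ) : Fintype.card (Fin 2 → ZMod (m + 5)) = (m + 5) ^ 2 := by
  rw [Fintype.card_fun, ZMod.card, Fintype.card_fin]

/-- The sites of the torus at which the letter is negative. -/
def negTorusSites (m : ℕ) (x : ℤ × ℤ → ℤ) : Finset (Fin 2 → ZMod (m + 5)) :=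
  Finset.univ.filter fun t => x (torusSite t) < 0

theorem mem_negTorusSites {t : Fin 2 → ZMod (m + 5)} :
    t ∈ negTorusSites m x ↔ x (torusSite t) < 0 := by
  rw [negTorusSites, Finset.mem_filter_univ]

theorem torusConfig_mem_biasedTorusConfigs (ε : ℤˣ) (hx : IsPlusConfig M m x)
    (hneg : ((negTorusSites m x).card : ℝ) ≤ 1 / 4 * ((m + 5 : ℕ) : ℝ) ^ 2) :
    torusConfig ε hx ∈ biasedTorusConfigs M m ε := by
  refine mem_biasedTorusConfigs.2 ⟨fun i t => (hx.icebergAllowed_torusSite i t).unit_mul ε, ?_⟩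
  have hsplit : ((negTorusSites m x).card : ℝ)
      + (Finset.univ.filter fun t : Fin 2 → ZMod (m + 5) =>
        ¬ x (torusSite t) < 0).card = ((m + 5 : ℕ) : ℝ) ^ 2 := by
    exact_mod_cast (Finset.card_filter_add_card_filter_not _).trans (card_torus m)
  simp only [torusConfig_mem_lettersOfSign]
  linarith

open scoped Classical in
theorem mul_card_filter_lt_card_le {α ι : Type*} [Fintype ι] [Nonempty ι] {Ω : Finset α}
    {N : α → Finset ι} {b c : ℝ}
    (hN : ∀ i, ((Ω.filter fun x => i ∈ N x).card : ℝ) ≤ c * Ω.card) :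
    b * (Ω.filter fun x => b * Fintype.card ι < (N x).card).card ≤ c * Ω.card := by
  have hι : (0 : ℝ) < Fintype.card ι := by exact_mod_cast Fintype.card_pos
  set B := Ω.filter fun x => b * Fintype.card ι < (N x).card
  refine le_of_mul_le_mul_right ?_ hι
  calc b * B.card * Fintype.card ι = ∑ _x ∈ B, b * (Fintype.card ι : ℝ) := by
        rw [Finset.sum_const, nsmul_eq_mul]
        ring
    _ ≤ ∑ x ∈ B, ((N x).card : ℝ) :=
        Finset.sum_le_sum fun x hx => (Finset.mem_filter.1 hx).2.le
    _ ≤ ∑ x ∈ Ω, ((N x).card : ℝ) :=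
        Finset.sum_le_sum_of_subset_of_nonneg (Finset.filter_subset _ _) fun _ _ _ =>
          Nat.cast_nonneg _
    _ = ∑ i, ((Ω.filter fun x => i ∈ N x).card : ℝ) := by
        simp only [← Nat.cast_sum, Finset.card_filter]
        rw [Finset.sum_comm]
        simp only [Finset.sum_boole, Finset.filter_univ_mem, Nat.cast_id]
    _ ≤ ∑ _i : ι, c * Ω.card := Finset.sum_le_sum fun i _ => hN i
    _ = c * Ω.card * Fintype.card ι := by
        rw [Finset.sum_const, nsmul_eq_mul, mul_comm, Finset.card_univ]

/-- The configurations with plus boundary condition for which at most a quarter of the sites of the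
torus carry a negative letter. -/
noncomputable def mostlyPlusConfigs (M m : ℕ) : Finset (ℤ × ℤ → ℤ) :=
  (plusConfigs M m).filter fun x => ((negTorusSites m x).card : ℝ) ≤ 1 / 4 * ((m + 5 : ℕ) : ℝ) ^ 2

theorem mem_mostlyPlusConfigs : x ∈ mostlyPlusConfigs M m ↔
    IsPlusConfig M m x ∧ ((negTorusSites m x).card : ℝ) ≤ 1 / 4 * ((m + 5 : ℕ) : ℝ) ^ 2 := by
  rw [mostlyPlusConfigs, Finset.mem_filter, mem_plusConfigs]

theorem card_plusConfigs_le_two_mul_card_mostlyPlusConfigs (hM : 2916 ≤ M) (m : ℕ) :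
    ((plusConfigs M m).card : ℝ) ≤ 2 * (mostlyPlusConfigs M m).card := by
  have hM' : (2916 : ℝ) ≤ M := by exact_mod_cast hM
  have hneg (t : Fin 2 → ZMod (m + 5)) :
      (((plusConfigs M m).filter fun x => x (torusSite t) < 0).card : ℝ)
        ≤ 1 / 8 * (plusConfigs M m).card := by
    refine (card_filter_neg_le (by lia) m (torusSite t)).trans ?_
    refine mul_le_mul_of_nonneg_right ?_ (Nat.cast_nonneg _)
    rw [div_le_div_iff₀ (by linarith) (by norm_num)]
    linarith
  have hmarkov : 1 / 4 * (((plusConfigs M m).filter fun x =>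
      ¬ ((negTorusSites m x).card : ℝ) ≤ 1 / 4 * ((m + 5 : ℕ) : ℝ) ^ 2).card : ℝ)
      ≤ 1 / 8 * (plusConfigs M m).card := by
    simpa only [card_torus, Nat.cast_pow, not_le] using
      mul_card_filter_lt_card_le (N := negTorusSites m) (b := 1 / 4)
        (by simpa only [mem_negTorusSites] using hneg)
  have hsplit : ((mostlyPlusConfigs M m).card : ℝ) + ((plusConfigs M m).filter fun x =>
      ¬ ((negTorusSites m x).card : ℝ) ≤ 1 / 4 * ((m + 5 : ℕ) : ℝ) ^ 2).card
      = (plusConfigs M m).card := by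
    rw [mostlyPlusConfigs, ← Nat.cast_add, Finset.card_filter_add_card_filter_not]
  linarith

theorem card_mostlyPlusConfigs_le (M m : ℕ) (ε : ℤˣ) :
    (mostlyPlusConfigs M m).card ≤ (biasedTorusConfigs M m ε).card := by
  have hconfig (x : mostlyPlusConfigs M m) : IsPlusConfig M m x := (mem_mostlyPlusConfigs.1 x.2).1
  exact Finset.card_le_card_of_injective
    (f := fun x => ⟨torusConfig ε (hconfig x),
      torusConfig_mem_biasedTorusConfigs ε _ (mem_mostlyPlusConfigs.1 x.2).2⟩)
    fun x y h => Subtype.ext (torusConfig_inj (hconfig x) (hconfig y) (congrArg Subtype.val h))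

theorem card_plusConfigs_le (hM : 2916 ≤ M) (m : ℕ) (ε : ℤˣ) :
    ((plusConfigs M m).card : ℝ) ≤ 2 * (biasedTorusConfigs M m ε).card := by
  refine (card_plusConfigs_le_two_mul_card_mostlyPlusConfigs hM m).trans ?_
  gcongr
  exact card_mostlyPlusConfigs_le M m ε

end TorusConfigs

section MultipleMeasures

variable {M : ℕ}

open scoped Classical in
theorem isTorusEnsemble_biasedTorusConfigs {m : ℕ} {ε : ℤˣ}
    (hne : (biasedTorusConfigs M m ε).Nonempty) : IsTorusEnsemble (biasedTorusConfigs M m ε) where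
  nonempty := hne
  translate_mem t y hy := by
    rw [mem_biasedTorusConfigs] at hy ⊢
    refine ⟨fun i s => by simpa only [add_assoc] using hy.1 i (t + s), hy.2.trans (le_of_eq ?_)⟩
    rw [Nat.cast_inj]
    exact (Finset.card_equiv (Equiv.addLeft t) fun s => by
      simp only [Finset.mem_filter_univ, Equiv.coe_addLeft]).symm

theorem nonempty_iceberg_carrier (hM : 0 < M) : (iceberg M).carrier.Nonempty :=
  ⟨fun _ => ⟨1, mem_icebergAlphabet.2 ⟨one_ne_zero, by rw [abs_one]; lia⟩⟩,
    mem_iceberg.2 fun _ _ => .inl ⟨one_pos, one_pos⟩⟩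

theorem HasTopologicalEntropy.tendsto_log_ncard_sub_div {d : ℕ} {A : Type} [TopologicalSpace A]
    {X : Subshift A (Fin d → ℤ)} {h : ℝ} (hh : HasTopologicalEntropy X h) (hd : d ≠ 0) (c : ℝ)
    (k : ℕ) :
    Tendsto (fun m : ℕ => (Real.log (languageOfShape X (box fun _ => m)).ncard - c)
      / ((m + k : ℕ) : ℝ) ^ d) atTop (𝓝 h) := by
  have hbox := hh.comp (tendsto_const_atTop_pi (ι := Fin d))
  have hratio : Tendsto (fun m : ℕ => (m : ℝ) / (m + k)) atTop (𝓝 1) :=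
    tendsto_natCast_div_add_atTop (k : ℝ)
  have hconst : Tendsto (fun m : ℕ => c / ((m : ℝ) + k) ^ d) atTop (𝓝 0) :=
    ((tendsto_pow_atTop hd).comp (tendsto_atTop_add_const_right _ _
      tendsto_natCast_atTop_atTop)).const_div_atTop c
  have hlim := (hbox.mul (hratio.pow d)).sub hconst
  rw [one_pow, mul_one, sub_zero] at hlim
  refine hlim.congr' ?_
  filter_upwards [eventually_gt_atTop 0] with m hm
  have hm' : (m : ℝ) ^ d ≠ 0 := by positivity
  simp only [Function.comp, Finset.prod_const, Finset.card_univ, Fintype.card_fin, Nat.cast_add,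
    div_pow]
  field_simp

theorem exists_biased_measureOfMaximalEntropy (hM : 2916 ≤ M) (ε : ℤˣ) :
    ∃ μ : Measure ((Fin 2 → ℤ) → IcebergAlphabet M), IsMeasureOfMaximalEntropy (iceberg M) μ ∧
      3 / 4 ≤ μ.real {x | x 0 ∈ lettersOfSign M ε} := by
  obtain ⟨h, hh, -⟩ := exists_hasTopologicalEntropy (iceberg M)
  have hlanguage (m : ℕ) : (0 : ℝ) < (languageOfShape (iceberg M) (box fun _ => m)).ncard := by
    exact_mod_cast ncard_languageOfShape_pos (nonempty_iceberg_carrier (by lia)) _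
  have hcard (m : ℕ) : ((languageOfShape (iceberg M) (box fun _ => m)).ncard : ℝ)
      ≤ 2 * (biasedTorusConfigs M m ε).card :=
    (Nat.cast_le.2 (ncard_languageOfShape_le_card_plusConfigs M m)).trans
      (card_plusConfigs_le hM m ε)
  have hpos (m : ℕ) : (0 : ℝ) < (biasedTorusConfigs M m ε).card := by
    linarith [hlanguage m, hcard m]
  refine exists_isMeasureOfMaximalEntropy_of_torus hh (tendsto_add_atTop_nat 5)
    (fun m => isTorusEnsemble_biasedTorusConfigs (Finset.card_pos.1 (Nat.cast_pos.1 (hpos m))))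
    (fun m y hy i t => not_not.2 ((mem_biasedTorusConfigs.1 hy).1 i t))
    (hh.tendsto_log_ncard_sub_div two_ne_zero (Real.log 2) 5) (fun m => ?_)
    fun m y hy => (mem_biasedTorusConfigs.1 hy).2
  rw [div_mul_cancel₀ _ (by positivity), sub_le_iff_le_add',
    ← Real.log_mul two_ne_zero (hpos m).ne']
  exact Real.log_le_log (hlanguage m) (hcard m)

theorem hasMultipleMME_iceberg (hM : 2916 ≤ M) : HasMultipleMME (iceberg M) := by
  obtain ⟨μ, hμ, hplus⟩ := exists_biased_measureOfMaximalEntropy hM 1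
  obtain ⟨ν, hν, hminus⟩ := exists_biased_measureOfMaximalEntropy hM (-1)
  refine ⟨μ, ν, hμ, hν, ?_⟩
  rintro rfl
  have := hμ.isProbabilityMeasure
  have hmeas : MeasurableSet {x : (Fin 2 → ℤ) → IcebergAlphabet M | x 0 ∈ lettersOfSign M (-1)} :=
    measurable_pi_apply (0 : Fin 2 → ℤ) (Set.toFinite _).measurableSet
  have hdisj : Disjoint {x : (Fin 2 → ℤ) → IcebergAlphabet M | x 0 ∈ lettersOfSign M 1}
      {x | x 0 ∈ lettersOfSign M (-1)} := by
    refine Set.disjoint_left.2 fun x hpos hneg => ?_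
    simp only [lettersOfSign, Set.mem_ofPred_eq, Units.val_neg, Units.val_one] at hpos hneg
    lia
  have hunion := measureReal_union (μ := μ) hdisj hmeas
  linarith [measureReal_le_one (μ := μ) (s := {x | x 0 ∈ lettersOfSign M 1} ∪
    {x | x 0 ∈ lettersOfSign M (-1)})]

end MultipleMeasures

section Crosses

/-- The position of a site in the cross containing it, for the tiling of `ℤ × ℤ` by the crosses
`crossSite c` with `c.1 + 2 * c.2` divisible by five. -/
def crossPosition (p : ℤ × ℤ) : Fin 5 := ⟨((p.1 + 2 * p.2) % 5).toNat, by lia⟩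

/-- The site at position `r` of the cross centered at `c`. -/
def crossSite (c : ℤ × ℤ) : Fin 5 → ℤ × ℤ :=
  ![c, (c.1 + 1, c.2), (c.1, c.2 + 1), (c.1, c.2 - 1), (c.1 - 1, c.2)]

/-- The center of the cross of the tiling containing `p`. -/
def crossCenter (p : ℤ × ℤ) : ℤ × ℤ :=
  ![p, (p.1 - 1, p.2), (p.1, p.2 - 1), (p.1, p.2 + 1), (p.1 + 1, p.2)] (crossPosition p)

variable {M : ℕ} {c p q : ℤ × ℤ}

theorem crossPosition_eq_iff {r : Fin 5} :
    crossPosition p = r ↔ (p.1 + 2 * p.2) % 5 = (r : ℕ) := by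
  rw [Fin.ext_iff, crossPosition]
  lia

theorem crossPosition_crossSite (hc : crossPosition c = 0) (r : Fin 5) :
    crossPosition (crossSite c r) = r := by
  rw [crossPosition_eq_iff, Fin.val_zero] at hc
  rw [crossPosition_eq_iff]
  fin_cases r <;> simp [crossSite] <;> lia

theorem crossCenter_crossSite (hc : crossPosition c = 0) (r : Fin 5) :
    crossCenter (crossSite c r) = c := by
  rw [crossCenter, crossPosition_crossSite hc]
  fin_cases r <;> simp [crossSite]

theorem crossCenter_eq_self (hp : crossPosition p = 0) : crossCenter p = p :=
  crossCenter_crossSite hp 0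

theorem LatticeAdj.exists_eq_crossSite (h : LatticeAdj p q) : ∃ r ≠ 0, q = crossSite p r := by
  obtain ⟨a, b⟩ := q
  rcases h with ⟨h₂, h₁ | h₁⟩ | ⟨h₁, h₂ | h₂⟩ <;> dsimp only at h₁ h₂
  · exact ⟨1, by decide, Prod.ext h₁ h₂.symm⟩
  · exact ⟨4, by decide, Prod.ext (eq_sub_of_add_eq h₁.symm) h₂.symm⟩
  · exact ⟨2, by decide, Prod.ext h₁.symm h₂⟩
  · exact ⟨3, by decide, Prod.ext h₁.symm (eq_sub_of_add_eq h₂.symm)⟩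

/-- The `M ^ 5 + 1` patterns on the cross used in the entropy bound: `none` has the letter `-1` at
the center and `1` elsewhere, and `some u` has the positive letters `u r + 1`. -/
def crossPattern : Option (Fin 5 → Fin M) → Fin 5 → ℤ
  | none, r => if r = 0 then -1 else 1
  | some u, r => (u r : ℕ) + 1

theorem crossPattern_ne_zero (w : Option (Fin 5 → Fin M)) (r : Fin 5) : crossPattern w r ≠ 0 := by
  cases w <;> grind [crossPattern]

theorem abs_crossPattern_le (hM : 0 < M) (w : Option (Fin 5 → Fin M)) (r : Fin 5) :
    |crossPattern w r| ≤ M := by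
  cases w <;> grind [crossPattern]

theorem crossPattern_neg_iff {w : Option (Fin 5 → Fin M)} {r : Fin 5} :
    crossPattern w r < 0 ↔ w = none ∧ r = 0 := by
  cases w <;> grind [crossPattern]

theorem crossPattern_injective :
    Function.Injective (crossPattern : Option (Fin 5 → Fin M) → Fin 5 → ℤ) := by
  intro w w' h
  have hnone : w = none ↔ w' = none := by
    simpa only [crossPattern_neg_iff, and_true] using iff_of_eq (congrArg (· < 0) (congrFun h 0))
  rcases w with _ | u <;> rcases w' with _ | u'
  · rfl
  · exact (hnone.1 rfl).symm
  · exact hnone.2 rfl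
  · refine congrArg some (funext fun r => Fin.ext ?_)
    simpa only [crossPattern, add_left_inj, Nat.cast_inj] using congrFun h r

/-- The configuration that shows the pattern `g c` in the cross centered at `c`. -/
def crossConfig (g : ℤ × ℤ → Option (Fin 5 → Fin M)) (p : ℤ × ℤ) : ℤ :=
  crossPattern (g (crossCenter p)) (crossPosition p)

variable {g : ℤ × ℤ → Option (Fin 5 → Fin M)}

theorem crossConfig_crossSite (hc : crossPosition c = 0) (r : Fin 5) :
    crossConfig g (crossSite c r) = crossPattern (g c) r := by
  rw [crossConfig, crossCenter_crossSite hc, crossPosition_crossSite hc]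

theorem icebergAllowed_crossConfig_of_neg (hp : crossConfig g p < 0) (hpq : LatticeAdj p q) :
    icebergAllowed (crossConfig g p) (crossConfig g q) := by
  obtain ⟨hnone, hpos⟩ := crossPattern_neg_iff.1 hp
  rw [crossCenter_eq_self hpos] at hnone
  obtain ⟨r, hr, rfl⟩ := hpq.exists_eq_crossSite
  rw [crossConfig_crossSite hpos, crossConfig, hpos, crossCenter_eq_self hpos, hnone]
  simp [crossPattern, icebergAllowed, hr]

theorem icebergAllowed_crossConfig (hpq : LatticeAdj p q) :
    icebergAllowed (crossConfig g p) (crossConfig g q) := by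
  rcases (crossPattern_ne_zero _ _ : crossConfig g p ≠ 0).lt_or_gt with hp | hp
  · exact icebergAllowed_crossConfig_of_neg hp hpq
  rcases (crossPattern_ne_zero _ _ : crossConfig g q ≠ 0).lt_or_gt with hq | hq
  · exact (icebergAllowed_crossConfig_of_neg hq hpq.symm).symm
  · exact .inl ⟨hp, hq⟩

/-- The configuration `crossConfig g` as a point of the full shift over the iceberg alphabet. -/
def crossPoint (hM : 0 < M) (g : ℤ × ℤ → Option (Fin 5 → Fin M)) (t : Fin 2 → ℤ) :
    IcebergAlphabet M :=
  ⟨crossConfig g (t 0, t 1),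
    mem_icebergAlphabet.2 ⟨crossPattern_ne_zero _ _, abs_crossPattern_le hM _ _⟩⟩

theorem crossPoint_mem_iceberg (hM : 0 < M) (g : ℤ × ℤ → Option (Fin 5 → Fin M)) :
    crossPoint hM g ∈ (iceberg M).carrier :=
  mem_iceberg.2 fun i t => icebergAllowed_crossConfig (by fin_cases i <;> simp [LatticeAdj])

/-- The centers of the crosses contained in the square `[1, 5 k + 2]²`. -/
def squareCenter (k : ℕ) (ab : Fin k × Fin (5 * k)) : ℤ × ℤ :=
  (5 * (ab.1 : ℕ) + (3 * (ab.2 : ℕ) + 4) % 5 + 2, (ab.2 : ℕ) + 2)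

theorem squareCenter_injective (k : ℕ) : Function.Injective (squareCenter k) := by
  rintro ⟨a, b⟩ ⟨a', b'⟩ h
  simp only [squareCenter, Prod.mk.injEq] at h
  obtain rfl : b = b' := Fin.ext (by lia)
  obtain rfl : a = a' := Fin.ext (by lia)
  rfl

theorem crossPosition_squareCenter {k : ℕ} (ab : Fin k × Fin (5 * k)) :
    crossPosition (squareCenter k ab) = 0 := by
  rw [crossPosition_eq_iff, squareCenter, Fin.val_zero]
  lia

theorem crossSite_squareCenter_mem_box {k : ℕ} (ab : Fin k × Fin (5 * k)) (r : Fin 5) :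
    ![(crossSite (squareCenter k ab) r).1, (crossSite (squareCenter k ab) r).2]
      ∈ box fun _ : Fin 2 => 5 * k + 2 := by
  have ha := ab.1.isLt
  have hb := ab.2.isLt
  rw [mem_box]
  intro i
  fin_cases r <;> fin_cases i <;> simp [crossSite, squareCenter] <;> lia

/-- The pattern on the square `[1, 5 k + 2]²` with the pattern `g ab` in the cross of index `ab`. -/
noncomputable def squarePattern (hM : 0 < M) {k : ℕ}
    (g : Fin k × Fin (5 * k) → Option (Fin 5 → Fin M)) :
    languageOfShape (iceberg M) (box fun _ => 5 * k + 2) :=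
  ⟨(box fun _ => 5 * k + 2).restrict
      (crossPoint hM (Function.extend (squareCenter k) g fun _ => none)),
    Set.mem_image_of_mem _ (crossPoint_mem_iceberg hM _)⟩

theorem squarePattern_apply_crossSite (hM : 0 < M) {k : ℕ}
    (g : Fin k × Fin (5 * k) → Option (Fin 5 → Fin M)) (ab : Fin k × Fin (5 * k)) (r : Fin 5) :
    ((squarePattern hM g).1 ⟨_, crossSite_squareCenter_mem_box ab r⟩).1
      = crossPattern (g ab) r := by
  rw [← (squareCenter_injective k).extend_apply g (fun _ => none) ab,
    ← crossConfig_crossSite (crossPosition_squareCenter ab)]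
  rfl

theorem squarePattern_injective (hM : 0 < M) {k : ℕ} :
    Function.Injective (squarePattern hM (k := k)) := fun g g' h =>
  funext fun ab => crossPattern_injective <| funext fun r => by
    rw [← squarePattern_apply_crossSite hM g, h, squarePattern_apply_crossSite]

theorem pow_le_ncard_languageOfShape_iceberg (hM : 0 < M) (k : ℕ) :
    (M ^ 5 + 1) ^ (5 * k ^ 2) ≤ (languageOfShape (iceberg M) (box fun _ => 5 * k + 2)).ncard := by
  calc (M ^ 5 + 1) ^ (5 * k ^ 2)
      = Nat.card (Fin k × Fin (5 * k) → Option (Fin 5 → Fin M)) := by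
        simp only [Nat.card_eq_fintype_card, Fintype.card_fun, Fintype.card_option,
          Fintype.card_fin, Fintype.card_prod]
        ring_nf
    _ ≤ (languageOfShape (iceberg M) (box fun _ => 5 * k + 2)).ncard :=
        Nat.card_le_card_of_injective _ (squarePattern_injective hM)

theorem log_pow_five_add_one_div_five_le_entropy (hM : 0 < M) {h : ℝ}
    (hh : HasTopologicalEntropy (iceberg M) h) : Real.log ((M : ℝ) ^ 5 + 1) / 5 ≤ h := by
  have hside : Tendsto (fun k : ℕ => 5 * k + 2) atTop atTop :=
    tendsto_atTop_mono (fun k => show k ≤ 5 * k + 2 by lia) tendsto_id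
  have hlim := hh.comp (tendsto_const_atTop_pi.comp hside)
  have hratio : Tendsto (fun k : ℕ => (k : ℝ) / (k + 2 / 5)) atTop (𝓝 1) :=
    tendsto_natCast_div_add_atTop (2 / 5)
  have hbound := (hratio.pow 2).mul_const (Real.log ((M : ℝ) ^ 5 + 1) / 5)
  rw [one_pow, one_mul] at hbound
  refine le_of_tendsto_of_tendsto' hbound hlim fun k => ?_
  have hlog := Real.log_le_log (by positivity)
    (Nat.cast_le (α := ℝ).2 (pow_le_ncard_languageOfShape_iceberg hM k))
  rw [Nat.cast_pow, Real.log_pow] at hlog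
  simp only [Function.comp, Fin.prod_univ_two]
  rw [le_div_iff₀ (by positivity)]
  refine le_trans (le_of_eq ?_) hlog
  push_cast
  field_simp

theorem mul_log_two_le_log_one_add {x : ℝ} (h₀ : 0 ≤ x) (h₁ : x ≤ 1) :
    x * Real.log 2 ≤ Real.log (1 + x) := by
  rw [← Real.log_rpow two_pos]
  refine Real.log_le_log (by positivity) ?_
  have := rpow_one_add_le_one_add_mul_self (s := 1) (by norm_num) h₀ h₁
  rwa [one_add_one_eq_two, mul_one] at this

theorem log_add_log_two_div_le {x : ℝ} (hx : 1 ≤ x) :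
    Real.log x + Real.log 2 / (5 * x ^ 5) ≤ Real.log (x ^ 5 + 1) / 5 := by
  have : 0 < x := by linarith
  have hlog : Real.log (x ^ 5 + 1) = 5 * Real.log x + Real.log (1 + (x ^ 5)⁻¹) := by
    rw [show x ^ 5 + 1 = x ^ 5 * (1 + (x ^ 5)⁻¹) by field_simp,
      Real.log_mul (by positivity) (by positivity), Real.log_pow, Nat.cast_ofNat]
  have hconcave := mul_log_two_le_log_one_add (x := (x ^ 5)⁻¹) (by positivity)
    (inv_le_one_of_one_le₀ (one_le_pow₀ hx))
  calc Real.log x + Real.log 2 / (5 * x ^ 5)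
      = (5 * Real.log x + (x ^ 5)⁻¹ * Real.log 2) / 5 := by field_simp
    _ ≤ Real.log (x ^ 5 + 1) / 5 := by linarith

theorem exists_iceberg_entropy_ge (hM : 0 < M) : ∃ h : ℝ, HasTopologicalEntropy (iceberg M) h ∧
    h ≥ Real.log (M : ℝ) + Real.log 2 / (5 * (M : ℝ) ^ 5) := by
  obtain ⟨h, hh, -⟩ := exists_hasTopologicalEntropy (iceberg M)
  exact ⟨h, hh, (log_add_log_two_div_le (Nat.one_le_cast.2 hM)).trans
    (log_pow_five_add_one_div_five_le_entropy hM hh)⟩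

end Crosses

section Alpha

theorem HasTopologicalEntropy.le_log_card {d : ℕ} {A : Type} [Fintype A] [TopologicalSpace A]
    {X : Subshift A (Fin d → ℤ)} {h : ℝ} (hh : HasTopologicalEntropy X h)
    (hX : X.carrier.Nonempty) : h ≤ Real.log (Fintype.card A) := by
  obtain ⟨h', hh', hle⟩ := exists_hasTopologicalEntropy X
  rw [tendsto_nhds_unique hh hh']
  calc h' ≤ Real.log (languageOfShape X (box fun _ => 1)).ncard := by
        simpa using hle (fun _ => 1) fun _ => one_pos
    _ ≤ Real.log (Fintype.card A) :=
        Real.log_le_log (Nat.cast_pos.2 (ncard_languageOfShape_pos hX _))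
          (Nat.cast_le.2 ((Set.ncard_le_card _).trans_eq (by simp [box])))

theorem zero_mem_lowerBounds_alphaSet (d : ℕ) : (0 : ℝ) ∈ lowerBounds (alphaSet d) := by
  rintro α ⟨A, _, _, _, _, _, F, hX, -, h, hh, hα⟩
  linarith [hh.le_log_card hX]

theorem card_icebergAlphabet (M : ℕ) : Fintype.card (IcebergAlphabet M) = 2 * M := by
  rw [Fintype.card_coe, Finset.card_erase_of_mem (by simp), Int.card_Icc]
  lia

theorem mem_alphaSet_two {M : ℕ} (hM : 2916 ≤ M) :
    Real.log 2 - Real.log 2 / (5 * (M : ℝ) ^ 5) ∈ alphaSet 2 := by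
  have hM₀ : 0 < M := by lia
  obtain ⟨h, hh, hge⟩ := exists_iceberg_entropy_ge hM₀
  refine ⟨IcebergAlphabet M, inferInstance, inferInstance, inferInstance, inferInstance,
    inferInstance, fun _ => {p | ¬ icebergAllowed p.1 p.2}, nonempty_iceberg_carrier hM₀,
    hasMultipleMME_iceberg hM, h, hh, ?_⟩
  rw [card_icebergAlphabet, Nat.cast_mul, Nat.cast_ofNat,
    Real.log_mul two_ne_zero (Nat.cast_ne_zero.2 hM₀.ne')]
  linarith

end Alpha

theorem theorem5p3 :
    IsGLB (alphaSet 2) (alpha 2) ∧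
    alpha 2 < Real.log 2 ∧
    alpha 2 ≤ Real.log 2 - Real.log 2 / (5 * 10 ^ 20) ∧
    (∀ M : ℕ, 0 < M → ∃ h : ℝ, HasTopologicalEntropy (iceberg M) h ∧
      h ≥ Real.log (M : ℝ) + Real.log 2 / (5 * (M : ℝ) ^ 5)) ∧
    (∀ M : ℕ, (M : ℝ) > 4 * Real.exp 1 * 28 ^ 2 → HasMultipleMME (iceberg M)) := by
  have hmem : Real.log 2 - Real.log 2 / (5 * 10 ^ 20) ∈ alphaSet 2 := by
    convert mem_alphaSet_two (M := 10 ^ 4) (by norm_num) using 3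
    norm_num
  have hglb : IsGLB (alphaSet 2) (alpha 2) :=
    isGLB_csInf ⟨_, hmem⟩ ⟨0, zero_mem_lowerBounds_alphaSet 2⟩
  have hle : alpha 2 ≤ Real.log 2 - Real.log 2 / (5 * 10 ^ 20) := hglb.1 hmem
  have hlt : alpha 2 < Real.log 2 := hle.trans_lt (sub_lt_self _ (by positivity))
  refine ⟨hglb, hlt, hle, fun M hM => exists_iceberg_entropy_ge hM, fun M hM => ?_⟩
  refine hasMultipleMME_iceberg (Nat.cast_le (α := ℝ).1 ?_)
  push_cast
  linarith [Real.exp_one_gt_d9]
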